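/- Let $-\infty<a<b<\infty$, $\alpha\in(0,1)$, and write $(-1)^x=e^{i\pi x}$ for real $x$; for a function $h$ on $(a,b)$ let $h(a+),h(b-)$ denote its one-sided limits. **Spaces.** For $\beta>0$, $W^\beta_1(a+)$ is the set of (Lebesgue) measurable $f:(a,b)\to\mathbb R$ such that $f(a+)\in\mathbb R$ exists and $$\|f\|_{W^\beta_1(a+)}=\int_a^b\frac{|f(t)|}{(t-a)^\beta}\,dt+\int_a^b\int_a^t\frac{|f(t)-f(s)|}{|t-s|^{1+\beta}}\,ds\,dt<\infty,$$ and $W^\beta_\infty(b-)$ is the set of measurable $g:(a,b)\to\mathbb R$ such that $g(b-)\in\mathbb R$ exists and $$\|g\|_{W^\beta_\infty(b-)}=\sup_{t\in(a,b)}\frac{|g(b-)-g(t)|}{(b-t)^\beta}+\sup_{t\in(a,b)}\int_t^b\frac{|g(t)-g(s)|}{|t-s|^{1+\beta}}\,ds<\infty.$$ **Fractional integrals and derivatives.** For $\beta>0$ and $\varphi,\psi\in L_1(a,b)$ (with $\varphi$ real, $\psi$ complex valued) let $$I^\beta_{a+}\varphi(t)=\frac1{\Gamma(\beta)}\int_a^t\frac{\varphi(s)}{(t-s)^{1-\beta}}\,ds,\qquad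 I^\beta_{b-}\psi(t)=\frac{(-1)^{-\beta}}{\Gamma(\beta)}\int_t^b\frac{\psi(s)}{(s-t)^{1-\beta}}\,ds,$$ and let $I^0_{a+},I^0_{b-}$ be the identity. These operators are one-to-one on $L_1$ (up to a.e. equality); their inverses are the Riemann–Liouville derivatives of order $\beta$. For $\beta\in(0,1)$ the Weyl–Marchaud derivatives are $$D^\beta_{a+}f(t)=\frac1{\Gamma(1-\beta)}\Big(\frac{f(t)}{(t-a)^\beta}+\beta\int_a^t\frac{f(t)-f(s)}{(t-s)^{\beta+1}}\,ds\Big),$$ $$D^\beta_{b-}g(t)=\frac{(-1)^\beta}{\Gamma(1-\beta)}\Big(\frac{g(t)}{(b-t)^\beta}+\beta\int_t^b\frac{g(t)-g(s)}{(s-t)^{\beta+1}}\,ds\Big).$$ **Zähle–Stieltjes integral.** Let $f,g$ be measurable real functions on $(a,b)$ for which $f(a+),g(a+),g(b-)\in\mathbb R$ exist. Call $(\gamma,p,q)$ admissible if $\gamma\in[0,1]$, $p,q\in[1,\infty]$, $1/p+1/q=1$, $f-f(a+)=I^\gamma_{a+}\varphi$ a.e. for some $\varphi\in L_p$, and $g-g(b-)=I^{1-\gamma}_{b-}\psi$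 a.e. for some $\psi\in L_q$. If an admissible triple exists, then $$(\mathrm{ZS})\int_a^bf_t\,dg_t=(-1)^\gamma\int_a^b\varphi(t)\psi(t)\,dt+f(a+)\big(g(b-)-g(a+)\big);$$ here $\varphi,\psi$ are the Riemann–Liouville derivatives of $f-f(a+)$ (of order $\gamma$) and of $g-g(b-)$ (of order $1-\gamma$). The integral is well defined if an admissible triple exists and the right-hand side is the same for all of them. **Proposition.** Let $f\in W^\alpha_1(a+)$ and $g\in W^{1-\alpha}_\infty(b-)$. Then: 1. The limit $g(a+)\in\mathbb R$ exists, $(\alpha,1,\infty)$ is admissible, and the Zähle–Stieltjes integral $(\mathrm{ZS})\int_a^bf_t\,dg_t$ is well defined and real. 2. The integral in $D^\alpha_{a+}f(t)$ converges absolutely for a.e. $t\in(a,b)$, the one in $D^{1-\alpha}_{b-}(g-g(b-))(t)$ for every $t\in(a,b)$, the products of Weyl–Marchaud derivatives below are integrable on $(a,b)$, and $$(\mathrm{ZS})\int_a^bf_t\,dg_t=(-1)^\alpha\int_a^bD^\alpha_{a+}(f-f(a+))(t)\,D^{1-\alpha}_{b-}(g-g(b-))(t)\,dt+f(a+)\big(g(b-)-g(a+)\big)$$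 $$=(-1)^\alpha\int_a^bD^\alpha_{a+}f(t)\,D^{1-\alpha}_{b-}(g-g(b-))(t)\,dt.$$ 3. The integral is bounded by $$\Big|(\mathrm{ZS})\int_a^bf_t\,dg_t\Big|\le\frac{\|f\|_{W^\alpha_1(a+)}\,\|g\|_{W^{1-\alpha}_\infty(b-)}}{\Gamma(\alpha)\Gamma(1-\alpha)}.$$ -/

import Mathlib

open MeasureTheory Set Filter Topology
open scoped ENNReal

noncomputable section

namespace ZahleStieltjes

/-- Lebesgue measure on the open interval `(a, b)`. -/
abbrev leb (a b : ℝ) : Measure ℝ := volume.restrict (Ioo a b)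

/-! ### Riemann-Liouville integrals and derivatives

Here `(-1) ^ x = exp (i π x)`, which is the value of the principal complex power at `-1`.
The right-sided operators therefore take complex values. -/

/-- The left Riemann-Liouville integral of order `α` of `φ` on `(a, b)`;
the one of order `0` is the identity. -/
def leftRL (a α : ℝ) (φ : ℝ → ℝ) (t : ℝ) : ℝ :=
  if α = 0 then φ t
  else (Real.Gamma α)⁻¹ * ∫ s in Ioo a t, φ s / (t - s) ^ (1 - α)

/-- The right Riemann-Liouville integral of order `α` of `ψ` on `(a, b)`;
the one of order `0` is the identity. -/
def rightRL (b α : ℝ) (ψ : ℝ → ℂ) (t : ℝ) : ℂ :=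
  if α = 0 then ψ t
  else (-1 : ℂ) ^ (-α : ℂ) / (Real.Gamma α : ℂ) *
    ∫ s in Ioo t b, ψ s / (((s - t) ^ (1 - α) : ℝ) : ℂ)

/-- `φ ∈ L_1(a, b)` is the left Riemann-Liouville derivative of order `α` of `f`, that is
`f = I^α_{a+} φ` almost everywhere on `(a, b)`. -/
def IsLeftRLDeriv (a b α : ℝ) (f φ : ℝ → ℝ) : Prop :=
  MemLp φ 1 (leb a b) ∧ f =ᵐ[leb a b] leftRL a α φ

/-- `ψ ∈ L_1(a, b)` is the right Riemann-Liouville derivative of order `α` of `g`, that is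
`g = I^α_{b-} ψ` almost everywhere on `(a, b)`. -/
def IsRightRLDeriv (a b α : ℝ) (g : ℝ → ℝ) (ψ : ℝ → ℂ) : Prop :=
  MemLp ψ 1 (leb a b) ∧ (fun t => (g t : ℂ)) =ᵐ[leb a b] rightRL b α ψ

/-! ### Weyl-Marchaud derivatives -/

/-- The left Weyl-Marchaud derivative `D^α_{a+} f`. -/
def leftD (a α : ℝ) (f : ℝ → ℝ) (t : ℝ) : ℝ :=
  (Real.Gamma (1 - α))⁻¹ *
    (f t / (t - a) ^ α + α * ∫ s in Ioo a t, (f t - f s) / (t - s) ^ (α + 1))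

/-- The right Weyl-Marchaud derivative `D^α_{b-} g`. -/
def rightD (b α : ℝ) (g : ℝ → ℝ) (t : ℝ) : ℂ :=
  (-1 : ℂ) ^ (α : ℂ) / (Real.Gamma (1 - α) : ℂ) *
    ((g t / (b - t) ^ α + α * ∫ s in Ioo t b, (g t - g s) / (s - t) ^ (α + 1) : ℝ) : ℂ)

/-! ### The fractional Zähle-Stieltjes integral -/

/-- The limits `f(a+)`, `g(a+)`, `g(b-)` exist, `f - f(a+) ∈ I^α_{a+}(L_p)`,
`g - g(b-) ∈ I^{1-α}_{b-}(L_q)`, and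
`I = (-1)^α ∫_a^b D^α_{a+}(f - f(a+)) D^{1-α}_{b-}(g - g(b-)) dt + f(a+) (g(b-) - g(a+))`.
The derivatives are those of Riemann and Liouville (the inverses of the fractional integrals),
which makes sense for all `α ∈ [0, 1]`. -/
def HasZSIntegralAt (a b : ℝ) (f g : ℝ → ℝ) (α : ℝ) (p q : ℝ≥0∞) (I : ℂ) : Prop :=
  AEMeasurable f (leb a b) ∧ AEMeasurable g (leb a b) ∧
  ∃ fa ga gb : ℝ,
    Tendsto f (𝓝[>] a) (𝓝 fa) ∧ Tendsto g (𝓝[>] a) (𝓝 ga) ∧ Tendsto g (𝓝[<] b) (𝓝 gb) ∧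
    ∃ (φ : ℝ → ℝ) (ψ : ℝ → ℂ),
      MemLp φ p (leb a b) ∧ IsLeftRLDeriv a b α (fun t => f t - fa) φ ∧
      MemLp ψ q (leb a b) ∧ IsRightRLDeriv a b (1 - α) (fun t => g t - gb) ψ ∧
      I = (-1 : ℂ) ^ (α : ℂ) * (∫ t in Ioo a b, (φ t : ℂ) * ψ t) + ((fa * (gb - ga) : ℝ) : ℂ)

/-- `I` is a value of the Zähle-Stieltjes integral of `f` against `g` over `(a, b)`, for some
`α ∈ [0, 1]` and some conjugate exponents `p, q ∈ [1, ∞]`. -/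
def HasZSIntegral (a b : ℝ) (f g : ℝ → ℝ) (I : ℂ) : Prop :=
  ∃ (α : ℝ) (p q : ℝ≥0∞), α ∈ Icc (0 : ℝ) 1 ∧ 1 ≤ p ∧ 1 ≤ q ∧ p⁻¹ + q⁻¹ = 1 ∧
    HasZSIntegralAt a b f g α p q I

open Classical in
/-- The Zähle-Stieltjes integral `(ZS) ∫_a^b f dg`, and `0` if there is none. -/
def zsIntegral (a b : ℝ) (f g : ℝ → ℝ) : ℝ :=
  if h : ∃ I : ℝ, HasZSIntegral a b f g (I : ℂ) then h.choose else 0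

/-! ### Fractional Sobolev-Slobodeckij spaces -/

/-- The norm of `W^α_1(a+)` on `(a, b)`, with values in `[0, ∞]`. -/
def normW1 (a b α : ℝ) (f : ℝ → ℝ) : ℝ≥0∞ :=
  (∫⁻ t in Ioo a b, ENNReal.ofReal (|f t| / (t - a) ^ α)) +
    ∫⁻ t in Ioo a b, ∫⁻ s in Ioo a t, ENNReal.ofReal (|f t - f s| / |t - s| ^ (1 + α))

/-- The norm of `W^α_∞(b-)` on `(a, b)`, with values in `[0, ∞]`; `Function.leftLim f b` is
`f(b-)`. -/
def normWInf (a b α : ℝ) (f : ℝ → ℝ) : ℝ≥0∞ :=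
  (⨆ t ∈ Ioo a b, ENNReal.ofReal (|Function.leftLim f b - f t| / (b - t) ^ α)) +
    ⨆ t ∈ Ioo a b, ∫⁻ s in Ioo t b, ENNReal.ofReal (|f t - f s| / |t - s| ^ (1 + α))

/-- `f ∈ W^α_1(a+)`; only the values of `f` on `(a, b)` matter. -/
def MemW1 (a b α : ℝ) (f : ℝ → ℝ) : Prop :=
  AEMeasurable f (leb a b) ∧ (∃ c : ℝ, Tendsto f (𝓝[>] a) (𝓝 c)) ∧ normW1 a b α f < ∞

/-- `f ∈ W^α_∞(b-)`; only the values of `f` on `(a, b)` matter. -/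
def MemWInf (a b α : ℝ) (f : ℝ → ℝ) : Prop :=
  AEMeasurable f (leb a b) ∧ (∃ c : ℝ, Tendsto f (𝓝[<] b) (𝓝 c)) ∧ normWInf a b α f < ∞

end ZahleStieltjes

end

/-! Both fractional integrals become convolutions on the line. After extension by zero, and
reflection at the origin on the right, each is convolution with one power kernel, up to the factor
`(-1) ^ (-β)`. Cutting the kernel off at `L = b - a` makes it integrable and changes nothing on the
interval. The semigroup law is then the Beta integral plus associativity, and since order one is the
primitive, the operators of order in `[0, 1]` are injective (`ae_eq_of_fracInt_ae_eq`).

Independence of the parameters: for `γ₁ ≤ γ₂` and `δ = γ₂ - γ₁`, injectivity gives `φ₁ = I^δ φ₂` and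
`ψ₂ = I^δ ψ₁`, so the pairings should agree by fractional integration by parts. The two pairs of
exponents are unrelated, so absolute convergence of the mixed double integral is not at hand.
Instead, each pairing is the value at `0` of a convolution. The two convolutions agree for a.e. `x <
0` by associativity in `L_1` (`conv_fracInt_comm`), and both are continuous by duality of the
exponents (`continuous_conv`), so they agree at `0`.

Existence: cutting off the singular integral near the diagonal, applying Fubini and passing to the
limit yields `I^1 D^α f = I^(1-α) f` for `f` of finite `W^α_1(a+)` norm. Injectivity of `I^(1-α)`
turns this into `f = I^α D^α f` (`ae_eq_leftRL_leftD`). Reflection gives the same for `g - g(b-)`,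
whose derivative is moreover bounded, so `p = 1`, `q = ∞` is admissible. The limit `g(a+)` comes
from a Hölder estimate obtained by averaging (`abs_sub_le_rpow`).

The Weyl-Marchaud derivative of the constant `f(a+)` is `f(a+) (t - a)^(-α) / Γ(1-α)`, a multiple of
the kernel of `I^(1-α)_{b-}` at the point `a`. Its pairing with `ψ` is therefore exactly the
boundary term, and the bound is the `L_1`-`L_∞` estimate of what remains. -/

namespace ZahleStieltjes

/-! ### Convolution of complex functions on the line -/

/-- The convolution of two complex functions on the line. -/
noncomputable def conv (u v : ℝ → ℂ) (x : ℝ) : ℂ := ∫ s, u s * v (x - s)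

lemma conv_comm (u v : ℝ → ℂ) : conv u v = conv v u := by
  funext x
  rw [conv, ← integral_sub_left_eq_self _ volume x]
  simp [conv, mul_comm]

lemma conv_const_mul (u v : ℝ → ℂ) (c : ℂ) (x : ℝ) :
    conv u (fun s => c * v s) x = c * conv u v x := by
  simp only [conv, ← integral_const_mul]
  congr 1; ext s; ring

lemma integrable_conv {u v : ℝ → ℂ} (hu : Integrable u) (hv : Integrable v) :
    Integrable (conv u v) := 
    hu.integrable_convolution (ContinuousLinearMap.mul ℝ ℂ) hv

lemma ae_integrable_conv_integrand {u v : ℝ → ℂ} (hu : Integrable u) (hv : Integrable v) :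
    ∀ᵐ x, Integrable (fun s => u s * v (x - s)) :=
  hu.ae_convolution_exists (ContinuousLinearMap.mul ℝ ℂ) hv

/-- Fubini applies at every `x` where the triple convolution of the absolute values is finite, which
is almost everywhere for integrable functions. -/
lemma conv_assoc_ae {u v w : ℝ → ℂ} (hu : Integrable u) (hv : Integrable v)
    (hw : Integrable w) : conv (conv u v) w =ᵐ[volume] conv u (conv v w) := by
  have h1 : Integrable (convolution (fun x => ‖v x‖) (fun x => ‖w x‖)
      (ContinuousLinearMap.mul ℝ ℝ) volume) := hv.norm.integrable_convolution _ hw.norm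
  filter_upwards [hu.norm.ae_convolution_exists (ContinuousLinearMap.mul ℝ ℝ) h1] with x hx
  exact convolution_assoc (ContinuousLinearMap.mul ℝ ℂ) (ContinuousLinearMap.mul ℝ ℂ)
    (ContinuousLinearMap.mul ℝ ℂ) (ContinuousLinearMap.mul ℝ ℂ) (fun a b c => mul_assoc a b c) hu.1 hv.1 hw.1
    (hu.ae_convolution_exists _ hv) (hv.norm.ae_convolution_exists _ hw.norm) hx

/-- For `q < ∞` the reflected translate `v (x - ·)` depends continuously on `x` in `L_q`, and
pairing with `u ∈ L_p` is a continuous functional. -/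
lemma continuous_conv_of_ne_top {p q : ℝ≥0∞} (hp : 1 ≤ p) (hq : 1 ≤ q) (hpq : p⁻¹ + q⁻¹ = 1)
    (hq' : q ≠ ∞) {u v : ℝ → ℂ} (hu : MemLp u p) (hv : MemLp v q) : Continuous (conv u v) := by
  have : Fact (1 ≤ p) := ⟨hp⟩
  have : Fact (1 ≤ q) := ⟨hq⟩
  have : p.HolderConjugate q := ⟨by simpa using hpq⟩
  let r : C(ℝ × ℝ, ℝ) := ⟨fun z => z.1 - z.2, by fun_prop⟩
  have hr : ∀ x, MeasurePreserving (r.curry x) (volume : Measure ℝ) volume :=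
    fun x => Measure.measurePreserving_sub_left volume x
  have h1 : Continuous fun x => Lp.compMeasurePreserving (r.curry x) (hr x) (hv.toLp v) :=
    continuous_const.compMeasurePreservingLp r.curry.continuous hr hq'
  have h2 : Continuous fun x =>
      (ContinuousLinearMap.mul ℂ ℂ).lpPairing volume p q (hu.toLp u)
        (Lp.compMeasurePreserving (r.curry x) (hr x) (hv.toLp v)) :=
    (ContinuousLinearMap.continuous _).comp h1
  convert! h2 using 2 with x
  rw [ContinuousLinearMap.lpPairing_eq_integral]
  refine integral_congr_ae ?_
  filter_upwards [hu.coeFn_toLp, Lp.coeFn_compMeasurePreserving (hv.toLp v) (hr x),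
    (hr x).quasiMeasurePreserving.ae_eq_comp hv.coeFn_toLp] with s h1 h2 h3
  rw [h1, h2, h3]
  rfl

lemma continuous_conv {p q : ℝ≥0∞} (hp : 1 ≤ p) (hq : 1 ≤ q) (hpq : p⁻¹ + q⁻¹ = 1)
    {u v : ℝ → ℂ} (hu : MemLp u p) (hv : MemLp v q) : Continuous (conv u v) := by
  -- Translation is not continuous in `L_∞`, but then `p = 1` and the roles of `u` and `v` can be
  -- exchanged.
  by_cases hq' : q = ∞
  · subst hq'
    have : p = 1 := by simpa using hpq
    subst this
    rw [conv_comm]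
    exact continuous_conv_of_ne_top le_top le_rfl (by simp) (by simp) hv hu
  · exact continuous_conv_of_ne_top hp hq hpq hq' hu hv

/-! ### The kernel of the Riemann-Liouville integral -/

/-- The kernel `x ^ (β - 1) / Γ(β)` of the Riemann-Liouville integral, cut off at `0` and `L`. -/
noncomputable def rlKernel (L β : ℝ) : ℝ → ℂ :=
  indicator (Ioo 0 L) fun x => ((x ^ (β - 1) / Real.Gamma β : ℝ) : ℂ)

lemma integrable_rlKernel (L : ℝ) {β : ℝ} (hβ : 0 < β) : Integrable (rlKernel L β) := by
  rw [rlKernel, integrable_indicator_iff measurableSet_Ioo]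
  rcases le_or_gt L 0 with hL | hL
  · simp [Ioo_eq_empty_of_le hL]
  refine Integrable.ofReal (Integrable.div_const ?_ _)
  have := intervalIntegral.intervalIntegrable_rpow' (a := 0) (b := L) (r := β - 1) (by linarith)
  rw [intervalIntegrable_iff_integrableOn_Ioo_of_le hL.le] at this
  exact this

lemma rlKernel_of_nonpos {L β x : ℝ} (hx : x ≤ 0) : rlKernel L β x = 0 :=
  indicator_of_notMem (fun h => absurd h.1 hx.not_gt) _

lemma rlKernel_of_mem {L β x : ℝ} (hx : x ∈ Ioo 0 L) :
    rlKernel L β x = ((x ^ (β - 1) / Real.Gamma β : ℝ) : ℂ) := indicator_of_mem hx _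

lemma conv_rlKernel_of_nonpos (L β γ : ℝ) {x : ℝ} (hx : x ≤ 0) :
    conv (rlKernel L β) (rlKernel L γ) x = 0 := by
  refine integral_eq_zero_of_ae (Eventually.of_forall fun s => ?_)
  rcases le_or_gt s 0 with hs | hs
  · simp [rlKernel_of_nonpos hs]
  · simp [rlKernel_of_nonpos (show x - s ≤ 0 by linarith)]

/-- This is the Beta integral `B(β, γ) = Γ(β) Γ(γ) / Γ(β + γ)`, scaled to `(0, x)`. For `x < L` the
cut-off at `L` is not seen. -/
lemma conv_rlKernel {L β γ : ℝ} (hβ : 0 < β) (hγ : 0 < γ) {x : ℝ} (hx : x < L) :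
    conv (rlKernel L β) (rlKernel L γ) x = rlKernel L (β + γ) x := by
  rcases le_or_gt x 0 with h0 | h0
  · rw [conv_rlKernel_of_nonpos L β γ h0, rlKernel_of_nonpos h0]
  have h1 : conv (rlKernel L β) (rlKernel L γ) x = ∫ s in Ioo 0 x,
      (s : ℂ) ^ ((β : ℂ) - 1) * ((x : ℂ) - s) ^ ((γ : ℂ) - 1) /
        (Real.Gamma β * Real.Gamma γ : ℝ) := by
    rw [conv, ← integral_indicator measurableSet_Ioo]
    congr 1; ext s
    by_cases hs : s ∈ Ioo 0 x
    · rw [indicator_of_mem hs, rlKernel_of_mem ⟨hs.1, hs.2.trans hx⟩,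
        rlKernel_of_mem ⟨by linarith [hs.2], by linarith [hs.1]⟩]
      push_cast
      rw [Complex.ofReal_cpow hs.1.le, Complex.ofReal_cpow (by linarith [hs.2])]
      push_cast
      ring
    · rw [indicator_of_notMem hs]
      rcases le_or_gt s 0 with h | h
      · simp [rlKernel_of_nonpos h]
      · have : x - s ≤ 0 := by
          by_contra! h'
          exact hs ⟨h, by linarith⟩
        simp [rlKernel_of_nonpos this]
  have hB := Complex.betaIntegral_scaled (β : ℂ) (γ : ℂ) h0
  rw [intervalIntegral.integral_of_le h0.le, integral_Ioc_eq_integral_Ioo] at hB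
  have hG := Complex.Gamma_mul_Gamma_eq_betaIntegral (s := (β : ℂ)) (t := (γ : ℂ))
    (by simpa using hβ) (by simpa using hγ)
  rw [h1, integral_div, hB, rlKernel_of_mem ⟨h0, hx⟩]
  have hb : Real.Gamma β ≠ 0 := (Real.Gamma_pos_of_pos hβ).ne'
  have hc : Real.Gamma γ ≠ 0 := (Real.Gamma_pos_of_pos hγ).ne'
  have hbc : Real.Gamma (β + γ) ≠ 0 := (Real.Gamma_pos_of_pos (add_pos hβ hγ)).ne'
  rw [← Complex.ofReal_add, Complex.Gamma_ofReal, Complex.Gamma_ofReal, Complex.Gamma_ofReal] at hG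
  push_cast
  rw [Complex.ofReal_cpow h0.le, div_eq_div_iff (by norm_cast; positivity) (by exact_mod_cast hbc),
    hG]
  push_cast
  ring

/-! ### Riemann-Liouville integration as a convolution operator -/

/-- The Riemann-Liouville integral of order `β` on the line, with kernel cut off at `L`. -/
noncomputable def fracInt (L β : ℝ) (w : ℝ → ℂ) : ℝ → ℂ :=
  if β = 0 then w else conv (rlKernel L β) w

lemma fracInt_zero (L : ℝ) (w : ℝ → ℂ) : fracInt L 0 w = w := if_pos rfl

lemma fracInt_of_pos (L : ℝ) {β : ℝ} (hβ : 0 < β) (w : ℝ → ℂ) :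
    fracInt L β w = conv (rlKernel L β) w := if_neg hβ.ne'

lemma integrable_fracInt (L : ℝ) {β : ℝ} (hβ : 0 ≤ β) {w : ℝ → ℂ} (hw : Integrable w) :
    Integrable (fracInt L β w) := by
  rcases hβ.eq_or_lt with rfl | h
  · rwa [fracInt_zero]
  · rw [fracInt_of_pos L h]
    exact integrable_conv (integrable_rlKernel L h) hw

lemma fracInt_const_mul (L β : ℝ) (w : ℝ → ℂ) (c : ℂ) (x : ℝ) :
    fracInt L β (fun s => c * w s) x = c * fracInt L β w x := by
  unfold fracInt
  split_ifs
  · rfl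
  · exact conv_const_mul _ _ _ _

lemma fracInt_of_le (L β : ℝ) {a : ℝ} {w : ℝ → ℂ} (hw : ∀ x ≤ a, w x = 0) {x : ℝ} (hx : x ≤ a) :
    fracInt L β w x = 0 := by
  unfold fracInt
  split_ifs
  · exact hw x hx
  · refine integral_eq_zero_of_ae (Eventually.of_forall fun s => ?_)
    rcases le_or_gt s 0 with hs | hs
    · simp [rlKernel_of_nonpos hs]
    · simp [hw (x - s) (by linarith)]

/-- The kernel lives on the positive half-line, so values at `x < b` only see the function to the
left of `b`. -/
lemma conv_rlKernel_congr (L β : ℝ) {b : ℝ} {w w' : ℝ → ℂ} (h : ∀ᵐ x, x < b → w x = w' x) {x : ℝ}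
    (hx : x < b) : conv (rlKernel L β) w x = conv (rlKernel L β) w' x := by
  refine integral_congr_ae ?_
  filter_upwards [(quasiMeasurePreserving_sub_left_of_right_invariant volume x).ae h] with s hs
  rcases le_or_gt s 0 with h0 | h0
  · simp [rlKernel_of_nonpos h0]
  · rw [hs (by linarith)]

lemma fracInt_congr (L β : ℝ) {b : ℝ} {w w' : ℝ → ℂ} (h : ∀ᵐ x, x < b → w x = w' x) :
    ∀ᵐ x, x < b → fracInt L β w x = fracInt L β w' x := by
  unfold fracInt
  split_ifs
  · exact h
  · exact Eventually.of_forall fun x hx => conv_rlKernel_congr L β h hx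

lemma fracInt_fracInt {L β γ a b : ℝ} (hβ : 0 ≤ β) (hγ : 0 ≤ γ) (hL : b ≤ a + L) {w : ℝ → ℂ}
    (hw : Integrable w) (hwa : ∀ x ≤ a, w x = 0) :
    ∀ᵐ x, x < b → fracInt L β (fracInt L γ w) x = fracInt L (β + γ) w x := by
  rcases hβ.eq_or_lt with rfl | hβ
  · simp [fracInt_zero]
  rcases hγ.eq_or_lt with rfl | hγ
  · simp [fracInt_zero]
  rw [fracInt_of_pos L hβ, fracInt_of_pos L hγ, fracInt_of_pos L (add_pos hβ hγ)]
  filter_upwards [conv_assoc_ae (integrable_rlKernel L hβ) (integrable_rlKernel L hγ) hw]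
    with x h hx
  rw [← h, conv, conv]
  congr 1; ext s
  rcases le_or_gt (x - s) a with h0 | h0
  · simp [hwa _ h0]
  -- Here `s < x - a < b - a ≤ L`, so the semigroup law of the kernels is available wherever `w (x -
  -- s)` need not vanish.
  · rw [conv_rlKernel hβ hγ (by linarith)]

/-- The kernel of order one is the indicator function of `(0, L)`. -/
lemma fracInt_one {L a b : ℝ} (hL : b ≤ a + L) {w : ℝ → ℂ} (hwa : ∀ x ≤ a, w x = 0) {x : ℝ}
    (hx : x < b) : fracInt L 1 w x = ∫ s in a..x, w s := by
  rcases le_or_gt x a with h | h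
  · rw [fracInt_of_le L 1 hwa h, intervalIntegral.integral_of_ge h,
      setIntegral_eq_zero_of_forall_eq_zero fun s hs => hwa s hs.2, neg_zero]
  · rw [fracInt_of_pos L one_pos, conv_comm, intervalIntegral.integral_of_le h.le,
      integral_Ioc_eq_integral_Ioo, ← integral_indicator measurableSet_Ioo]
    refine integral_congr_ae (Eventually.of_forall fun s => ?_)
    simp only
    by_cases hs : s ∈ Ioo a x
    · rw [indicator_of_mem hs, rlKernel_of_mem ⟨by linarith [hs.2], by linarith [hs.1]⟩]
      simp
    · rw [indicator_of_notMem hs]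
      rcases le_or_gt s a with h' | h'
      · simp [hwa s h']
      · rw [rlKernel_of_nonpos, mul_zero]
        by_contra! h2
        exact hs ⟨h', by linarith⟩

/-- The Riemann-Liouville integral of order `β ∈ [0, 1]` is one-to-one on integrable functions. -/
lemma ae_eq_of_fracInt_ae_eq {L β a b : ℝ} (hβ : 0 ≤ β) (hβ1 : β ≤ 1) (hL : b ≤ a + L)
    {w w' : ℝ → ℂ} (hw : Integrable w) (hw' : Integrable w') (hwa : ∀ x ≤ a, w x = 0)
    (hwa' : ∀ x ≤ a, w' x = 0) (h : ∀ᵐ x, x < b → fracInt L β w x = fracInt L β w' x) :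
    ∀ᵐ x, x < b → w x = w' x := by
  -- Applying the integral of the complementary order `1 - β` to both sides produces primitives, by
  -- the semigroup law.
  have h1 : ∀ᵐ x, x < b → ∫ s in a..x, w s = ∫ s in a..x, w' s := by
    filter_upwards [fracInt_fracInt (sub_nonneg.2 hβ1) hβ hL hw hwa,
      fracInt_fracInt (sub_nonneg.2 hβ1) hβ hL hw' hwa', fracInt_congr L (1 - β) h]
      with x h1 h2 h3 hx
    rw [← fracInt_one hL hwa hx, ← fracInt_one hL hwa' hx]
    have := (h1 hx).symm.trans ((h3 hx).trans (h2 hx))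
    simpa using this
  -- Continuity removes the exceptional set, after which Lebesgue differentiation recovers the
  -- integrands.
  have h2 : EqOn (fun x => ∫ s in a..x, w s) (fun x => ∫ s in a..x, w' s) (Iio b) :=
    Measure.eqOn_open_of_ae_eq ((ae_restrict_iff' measurableSet_Iio).2 h1) isOpen_Iio
      (intervalIntegral.continuous_primitive (fun _ _ => hw.intervalIntegrable) a).continuousOn
      (intervalIntegral.continuous_primitive (fun _ _ => hw'.intervalIntegrable) a).continuousOn
  filter_upwards [LocallyIntegrable.ae_hasDerivAt_integral hw.locallyIntegrable,
    LocallyIntegrable.ae_hasDerivAt_integral hw'.locallyIntegrable] with x h3 h4 hx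
  exact (h3 a).unique ((h4 a).congr_of_eventuallyEq (h2.eventuallyEq_of_mem (Iio_mem_nhds hx)))

/-- Fractional integration by parts, off the diagonal. -/
lemma conv_fracInt_comm {L δ a b : ℝ} (hδ : 0 ≤ δ) {u₁ u₂ v₁ v₂ : ℝ → ℂ} {c : ℂ}
    (hu₂ : Integrable u₂) (hv₁ : Integrable v₁) (hua : ∀ x ≤ a, u₂ x = 0)
    (hvb : ∀ x ≤ -b, v₁ x = 0) (hu : ∀ᵐ x, x < b → u₁ x = fracInt L δ u₂ x)
    (hv : ∀ᵐ x, x < -a → v₂ x = c * fracInt L δ v₁ x) :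
    ∀ᵐ x, x < 0 → conv u₂ v₂ x = c * conv u₁ v₁ x := by
  have key : conv (fracInt L δ u₂) v₁ =ᵐ[volume] conv u₂ (fracInt L δ v₁) := by
    rcases hδ.eq_or_lt with rfl | hδ
    · simp only [fracInt_zero]; rfl
    · rw [fracInt_of_pos L hδ, fracInt_of_pos L hδ, conv_comm (rlKernel L δ) u₂]
      exact conv_assoc_ae hu₂ (integrable_rlKernel L hδ) hv₁
  filter_upwards [key] with x hx hx0
  -- The condition `x < 0` enters here: `u₂ s` can be nonzero only for `s > a`, where `x - s < -a`
  -- lies in the range where `v₂` is known. Dually, `v₁ (x - s)` can be nonzero only where `s < b`.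
  have h1 : conv u₂ v₂ x = c * conv u₂ (fracInt L δ v₁) x := by
    rw [← conv_const_mul]
    refine integral_congr_ae ?_
    filter_upwards [(quasiMeasurePreserving_sub_left_of_right_invariant volume x).ae hv] with s hs
    rcases le_or_gt s a with h0 | h0
    · simp [hua s h0]
    · rw [hs (by linarith)]
  have h2 : conv u₁ v₁ x = conv (fracInt L δ u₂) v₁ x := by
    refine integral_congr_ae ?_
    filter_upwards [hu] with s hs
    rcases le_or_gt (x - s) (-b) with h0 | h0
    · simp [hvb _ h0]
    · rw [hs (by linarith)]
  rw [h1, h2, hx]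

/-! ### One-sided operators as operators on the line -/

/-- The extension by zero of a real function on `(a, b)`, with complex values. -/
noncomputable def leftExt (a b : ℝ) (φ : ℝ → ℝ) : ℝ → ℂ := indicator (Ioo a b) fun t => (φ t : ℂ)

/-- The reflection at the origin of the extension by zero of a function on `(a, b)`. -/
noncomputable def rightExt (a b : ℝ) (ψ : ℝ → ℂ) (x : ℝ) : ℂ := indicator (Ioo a b) ψ (-x)

section
variable {a b : ℝ}

lemma leftExt_of_le (φ : ℝ → ℝ) {x : ℝ} (hx : x ≤ a) : leftExt a b φ x = 0 :=
  indicator_of_notMem (fun h => absurd h.1 hx.not_gt) _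

lemma rightExt_of_le (ψ : ℝ → ℂ) {x : ℝ} (hx : x ≤ -b) : rightExt a b ψ x = 0 :=
  indicator_of_notMem (fun h => absurd h.2 (by linarith)) _

lemma leftExt_of_mem (φ : ℝ → ℝ) {x : ℝ} (hx : x ∈ Ioo a b) : leftExt a b φ x = φ x :=
  indicator_of_mem hx _

lemma rightExt_neg_of_mem (ψ : ℝ → ℂ) {x : ℝ} (hx : x ∈ Ioo a b) :
    rightExt a b ψ (-x) = ψ x := by
  rw [rightExt, neg_neg, indicator_of_mem hx]

lemma memLp_leftExt {φ : ℝ → ℝ} {p : ℝ≥0∞} (h : MemLp φ p (leb a b)) :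
    MemLp (leftExt a b φ) p :=
  (memLp_indicator_iff_restrict measurableSet_Ioo).2 h.ofReal

lemma memLp_rightExt {ψ : ℝ → ℂ} {q : ℝ≥0∞} (h : MemLp ψ q (leb a b)) :
    MemLp (rightExt a b ψ) q :=
  ((memLp_indicator_iff_restrict measurableSet_Ioo).2 h).comp_measurePreserving
    (Measure.measurePreserving_neg volume)

lemma integrable_leftExt {φ : ℝ → ℝ} (h : MemLp φ 1 (leb a b)) : Integrable (leftExt a b φ) :=
  memLp_one_iff_integrable.1 (memLp_leftExt h)

lemma integrable_rightExt {ψ : ℝ → ℂ} (h : MemLp ψ 1 (leb a b)) :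
    Integrable (rightExt a b ψ) :=
  memLp_one_iff_integrable.1 (memLp_rightExt h)

lemma conv_leftExt_rightExt_zero (φ : ℝ → ℝ) (ψ : ℝ → ℂ) :
    conv (leftExt a b φ) (rightExt a b ψ) 0 = ∫ t in Ioo a b, (φ t : ℂ) * ψ t := by
  rw [conv, ← integral_indicator measurableSet_Ioo]
  congr 1; ext s
  by_cases hs : s ∈ Ioo a b
  · rw [zero_sub, leftExt_of_mem φ hs, rightExt_neg_of_mem ψ hs, indicator_of_mem hs]
  · simp [leftExt, indicator_of_notMem hs]

lemma leftRL_eq_fracInt {β : ℝ} (hβ : 0 ≤ β) (φ : ℝ → ℝ) {t : ℝ} (ht : t ∈ Ioo a b) :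
    (leftRL a β φ t : ℂ) = fracInt (b - a) β (leftExt a b φ) t := by
  rcases hβ.eq_or_lt with rfl | hβ
  · rw [fracInt_zero, leftExt_of_mem φ ht, leftRL, if_pos rfl]
  rw [fracInt_of_pos _ hβ, leftRL, if_neg hβ.ne', conv_comm, conv, ← integral_const_mul,
    ← integral_complex_ofReal, ← integral_indicator measurableSet_Ioo]
  congr 1; ext s
  by_cases hs : s ∈ Ioo a t
  · rw [indicator_of_mem hs, leftExt_of_mem φ ⟨hs.1, hs.2.trans ht.2⟩,
      rlKernel_of_mem ⟨by linarith [hs.2], by linarith [hs.1, ht.2]⟩, ← neg_sub 1 β,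
      Real.rpow_neg (by linarith [hs.2])]
    push_cast
    ring
  · rw [indicator_of_notMem hs]
    rcases le_or_gt s a with h | h
    · simp [leftExt_of_le φ h]
    · rw [rlKernel_of_nonpos, mul_zero]
      by_contra! h'
      exact hs ⟨h, by linarith⟩

lemma rightRL_eq_fracInt {β : ℝ} (hβ : 0 ≤ β) (ψ : ℝ → ℂ) {t : ℝ} (ht : t ∈ Ioo a b) :
    rightRL b β ψ t = (-1 : ℂ) ^ (-β : ℂ) * fracInt (b - a) β (rightExt a b ψ) (-t) := by
  rcases hβ.eq_or_lt with rfl | hβ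
  · rw [fracInt_zero, rightExt_neg_of_mem ψ ht, rightRL, if_pos rfl]
    simp
  rw [fracInt_of_pos _ hβ, rightRL, if_neg hβ.ne', conv_comm, conv, div_mul_eq_mul_div, mul_div_assoc]
  congr 1
  rw [← integral_div, ← integral_indicator measurableSet_Ioo,
    ← integral_neg_eq_self (fun s => rightExt a b ψ s * rlKernel (b - a) β (-t - s))]
  congr 1; ext s
  by_cases hs : s ∈ Ioo t b
  · rw [indicator_of_mem hs, rightExt_neg_of_mem ψ ⟨ht.1.trans hs.1, hs.2⟩,
      rlKernel_of_mem ⟨by linarith [hs.1], by linarith [hs.2, ht.1]⟩, ← neg_sub 1 β,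
      Real.rpow_neg (by linarith [hs.1]), neg_sub_neg]
    push_cast
    ring
  · rw [indicator_of_notMem hs]
    rcases le_or_gt b s with h | h
    · simp [rightExt_of_le ψ (neg_le_neg h)]
    · rw [rlKernel_of_nonpos, mul_zero]
      by_contra! h'
      exact hs ⟨by linarith, h⟩

/-- To the left of `a` both sides vanish. To the right of `b` the integral of the extension need not
vanish, hence the restriction to `x < b`. -/
lemma ae_eq_leftRL_iff {β : ℝ} (hβ : 0 ≤ β) (f φ : ℝ → ℝ) :
    f =ᵐ[leb a b] leftRL a β φ ↔
      ∀ᵐ x, x < b → leftExt a b f x = fracInt (b - a) β (leftExt a b φ) x := by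
  rw [EventuallyEq, ae_restrict_iff' measurableSet_Ioo]
  refine ⟨fun h => h.mono fun x hx hxb => ?_, fun h => h.mono fun x hx hxab => ?_⟩
  · rcases le_or_gt x a with h' | h'
    · rw [leftExt_of_le f h', fracInt_of_le _ _ (fun y hy => leftExt_of_le φ hy) h']
    · rw [leftExt_of_mem f ⟨h', hxb⟩, ← leftRL_eq_fracInt hβ φ ⟨h', hxb⟩, hx ⟨h', hxb⟩]
  · have := hx hxab.2
    rw [leftExt_of_mem f hxab, ← leftRL_eq_fracInt hβ φ hxab] at this
    exact_mod_cast this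

lemma ae_eq_rightRL_iff {β : ℝ} (hβ : 0 ≤ β) (g ψ : ℝ → ℂ) :
    g =ᵐ[leb a b] rightRL b β ψ ↔ ∀ᵐ x, x < -a →
      rightExt a b g x = (-1 : ℂ) ^ (-β : ℂ) * fracInt (b - a) β (rightExt a b ψ) x := by
  rw [EventuallyEq, ae_restrict_iff' measurableSet_Ioo]
  constructor <;> intro h
  · filter_upwards [(Measure.measurePreserving_neg volume).quasiMeasurePreserving.ae h] with x hx hxa
    rcases le_or_gt x (-b) with h' | h'
    · rw [rightExt_of_le g h', fracInt_of_le _ _ (fun y hy => rightExt_of_le ψ hy) h', mul_zero]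
    · have hm : -x ∈ Ioo a b := ⟨by linarith, by linarith⟩
      have h2 := rightRL_eq_fracInt hβ ψ hm
      have h3 := rightExt_neg_of_mem g hm
      rw [neg_neg] at h2 h3
      rw [h3, ← h2, hx hm]
  · filter_upwards [(Measure.measurePreserving_neg volume).quasiMeasurePreserving.ae h] with x hx hxab
    have := hx (by linarith [hxab.1])
    rwa [rightExt_neg_of_mem g hxab, ← rightRL_eq_fracInt hβ ψ hxab] at this

/-! ### Independence of the admissible parameters -/

lemma neg_one_cpow_mul (x y : ℝ) :
    (-1 : ℂ) ^ (x : ℂ) * (-1 : ℂ) ^ (y : ℂ) = (-1 : ℂ) ^ ((x + y : ℝ) : ℂ) := by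
  rw [Complex.ofReal_add, Complex.cpow_add _ _ (by norm_num)]

lemma neg_one_cpow_neg_mul (x : ℝ) : (-1 : ℂ) ^ (x : ℂ) * (-1 : ℂ) ^ (-x : ℂ) = 1 := by
  rw [← Complex.cpow_add _ _ (by norm_num), add_neg_cancel, Complex.cpow_zero]

/-- The order `δ = γ₂ - γ₁` is moved from one factor of the pairing to the other. The integration by
parts is made for convolutions at a.e. `x < 0` and reaches `x = 0` by continuity. -/
lemma hasZSIntegralAt_unique_of_le {f g : ℝ → ℝ} {γ₁ γ₂ : ℝ} {p₁ q₁ p₂ q₂ : ℝ≥0∞} {I₁ I₂ : ℂ}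
    (h0 : 0 ≤ γ₁) (h12 : γ₁ ≤ γ₂) (h1 : γ₂ ≤ 1)
    (hp₁ : 1 ≤ p₁) (hq₁ : 1 ≤ q₁) (hpq₁ : p₁⁻¹ + q₁⁻¹ = 1)
    (hp₂ : 1 ≤ p₂) (hq₂ : 1 ≤ q₂) (hpq₂ : p₂⁻¹ + q₂⁻¹ = 1)
    (H₁ : HasZSIntegralAt a b f g γ₁ p₁ q₁ I₁) (H₂ : HasZSIntegralAt a b f g γ₂ p₂ q₂ I₂) :
    I₁ = I₂ := by
  obtain ⟨-, -, fa, ga, gb, hfa, hga, hgb, φ₁, ψ₁, hφ₁, ⟨hφ₁i, hf₁⟩, hψ₁, ⟨hψ₁i, hg₁⟩, rfl⟩ := H₁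
  obtain ⟨-, -, fa', ga', gb', hfa', hga', hgb', φ₂, ψ₂, hφ₂, ⟨hφ₂i, hf₂⟩, hψ₂, ⟨hψ₂i, hg₂⟩, rfl⟩ :=
    H₂
  obtain rfl := tendsto_nhds_unique hfa hfa'
  obtain rfl := tendsto_nhds_unique hga hga'
  obtain rfl := tendsto_nhds_unique hgb hgb'
  set δ := γ₂ - γ₁ with hδ
  have hδ0 : 0 ≤ δ := by linarith
  have hL : b ≤ a + (b - a) := by linarith
  have hL' : -a ≤ -b + (b - a) := by linarith
  have hγ₂ : 0 ≤ γ₂ := h0.trans h12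
  rw [ae_eq_leftRL_iff h0] at hf₁
  rw [ae_eq_leftRL_iff hγ₂] at hf₂
  rw [ae_eq_rightRL_iff (by linarith)] at hg₁ hg₂
  have iu₁ := integrable_leftExt hφ₁i
  have iu₂ := integrable_leftExt hφ₂i
  have iv₁ := integrable_rightExt hψ₁i
  have iv₂ := integrable_rightExt hψ₂i
  have zu : ∀ φ : ℝ → ℝ, ∀ x ≤ a, leftExt a b φ x = 0 := fun φ x hx => leftExt_of_le φ hx
  have zv : ∀ ψ : ℝ → ℂ, ∀ x ≤ -b, rightExt a b ψ x = 0 := fun ψ x hx => rightExt_of_le ψ hx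
  -- Cancel `I^γ₁` in `I^γ₁ φ₁ = f - f(a+) = I^γ₁ I^δ φ₂`.
  have hu : ∀ᵐ x, x < b → leftExt a b φ₁ x = fracInt (b - a) δ (leftExt a b φ₂) x := by
    refine ae_eq_of_fracInt_ae_eq h0 (h12.trans h1) hL iu₁ (integrable_fracInt _ hδ0 iu₂) (zu φ₁)
      (fun x hx => fracInt_of_le _ _ (zu φ₂) hx) ?_
    filter_upwards [hf₁, hf₂, fracInt_fracInt h0 hδ0 hL iu₂ (zu φ₂)] with x k1 k2 k3 hx
    rw [k3 hx, ← k1 hx, k2 hx, hδ, add_sub_cancel]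
  set c : ℂ := (-1 : ℂ) ^ (-δ : ℂ) with hc
  have hcc : (-1 : ℂ) ^ (-(1 - γ₁ : ℝ) : ℂ) = (-1 : ℂ) ^ (-(1 - γ₂ : ℝ) : ℂ) * c := by
    rw [hc, ← Complex.cpow_add _ _ (by norm_num)]
    congr 1
    rw [hδ]; push_cast; ring
  have hne : ∀ z : ℂ, (-1 : ℂ) ^ z ≠ 0 := fun z => by simp [Complex.cpow_eq_zero_iff]
  -- Cancel `I^(1-γ₂)` on the right, where `1 - γ₁ = (1 - γ₂) + δ`; the constant `c` carries the
  -- leftover phase `(-1) ^ (-δ)`.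
  have hv : ∀ᵐ x, x < -a → rightExt a b ψ₂ x = c * fracInt (b - a) δ (rightExt a b ψ₁) x := by
    refine ae_eq_of_fracInt_ae_eq (β := 1 - γ₂) (by linarith) (by linarith) hL' iv₂
      ((integrable_fracInt _ hδ0 iv₁).const_mul c) (zv ψ₂)
      (fun x hx => by rw [fracInt_of_le _ _ (zv ψ₁) hx, mul_zero]) ?_
    filter_upwards [hg₁, hg₂, fracInt_fracInt (β := 1 - γ₂) (by linarith) hδ0 hL' iv₁ (zv ψ₁)]
      with x k1 k2 k3 hx
    rw [fracInt_const_mul, k3 hx]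
    refine mul_left_cancel₀ (hne (-(1 - γ₂ : ℝ) : ℂ)) ?_
    rw [← mul_assoc, ← hcc, ← k2 hx, k1 hx, hδ]
    congr 3
    ring
  have h3 : EqOn (conv (leftExt a b φ₂) (rightExt a b ψ₂))
      (fun x => c * conv (leftExt a b φ₁) (rightExt a b ψ₁) x) (closure (Iio 0)) := by
    have k2 := continuous_conv hp₂ hq₂ hpq₂ (memLp_leftExt hφ₂) (memLp_rightExt hψ₂)
    have k1 := (continuous_conv hp₁ hq₁ hpq₁ (memLp_leftExt hφ₁)
      (memLp_rightExt hψ₁)).const_mul c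
    refine EqOn.closure (Measure.eqOn_open_of_ae_eq (μ := volume) ?_ isOpen_Iio
      k2.continuousOn k1.continuousOn) k2 k1
    exact (ae_restrict_iff' measurableSet_Iio).2
      (conv_fracInt_comm hδ0 iu₂ iv₁ (zu φ₂) (zv ψ₁) hu hv)
  have h4 := h3 (show (0 : ℝ) ∈ closure (Iio 0) by simp)
  simp only [conv_leftExt_rightExt_zero] at h4
  rw [h4, ← mul_assoc]
  congr 2
  rw [hc, ← Complex.cpow_add _ _ (by norm_num), hδ]
  congr 1
  push_cast; ring

/-- The value of the Zähle-Stieltjes integral does not depend on the admissible parameters. -/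
lemma HasZSIntegral.unique {f g : ℝ → ℝ} {I J : ℂ}
    (hI : HasZSIntegral a b f g I) (hJ : HasZSIntegral a b f g J) : I = J := by
  obtain ⟨γ₁, p₁, q₁, hγ₁, hp₁, hq₁, hpq₁, H₁⟩ := hI
  obtain ⟨γ₂, p₂, q₂, hγ₂, hp₂, hq₂, hpq₂, H₂⟩ := hJ
  rcases le_total γ₁ γ₂ with h | h
  · exact hasZSIntegralAt_unique_of_le hγ₁.1 h hγ₂.2 hp₁ hq₁ hpq₁ hp₂ hq₂ hpq₂ H₁ H₂
  · exact (hasZSIntegralAt_unique_of_le hγ₂.1 h hγ₁.2 hp₂ hq₂ hpq₂ hp₁ hq₁ hpq₁ H₂ H₁).symm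

lemma zsIntegral_eq {f g : ℝ → ℝ} {I : ℝ} (hI : HasZSIntegral a b f g (I : ℂ)) :
    zsIntegral a b f g = I := by
  have h : ∃ I : ℝ, HasZSIntegral a b f g (I : ℂ) := ⟨I, hI⟩
  rw [zsIntegral, dif_pos h]
  exact_mod_cast HasZSIntegral.unique h.choose_spec hI

end

/-! ### The Weyl-Marchaud derivative inverts the Riemann-Liouville integral -/

/-- The kernel `r ^ (-(α + 1))`, cut off to `(ε, ∞)`. -/
noncomputable def truncKernel (α ε : ℝ) : ℝ → ℝ := indicator (Ioi ε) fun r => (r ^ (α + 1))⁻¹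

lemma measurable_truncKernel (α ε : ℝ) : Measurable (truncKernel α ε) :=
  Measurable.indicator (by fun_prop) measurableSet_Ioi

lemma abs_truncKernel_le {α ε : ℝ} (hα : 0 < α) (hε : 0 < ε) (r : ℝ) :
    ‖truncKernel α ε r‖ ≤ (ε ^ (α + 1))⁻¹ := by
  by_cases h : r ∈ Ioi ε
  · have h' : ε < r := h
    have hr : 0 < r := hε.trans h'
    rw [truncKernel, indicator_of_mem h, Real.norm_of_nonneg (by positivity)]
    gcongr
  · rw [truncKernel, indicator_of_notMem h, norm_zero]
    positivity

/-- The positive part of `R ^ (-α) - ε ^ (-α)`. -/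
noncomputable def cutRemainder (α ε R : ℝ) : ℝ := if R < ε then (R ^ α)⁻¹ - (ε ^ α)⁻¹ else 0

lemma measurable_cutRemainder (α ε : ℝ) : Measurable (cutRemainder α ε) :=
  Measurable.ite measurableSet_Iio (by fun_prop) measurable_const

lemma abs_cutRemainder_le {α ε R : ℝ} (hα : 0 < α) (hR : 0 < R) :
    |cutRemainder α ε R| ≤ (R ^ α)⁻¹ := by
  rw [cutRemainder]
  split_ifs with h
  · have h1 : (ε ^ α)⁻¹ ≤ (R ^ α)⁻¹ := by gcongr
    have h2 : 0 < ε ^ α := Real.rpow_pos_of_pos (hR.trans h) _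
    rw [abs_of_nonneg (by linarith)]
    have : 0 < (ε ^ α)⁻¹ := by positivity
    linarith
  · rw [abs_zero]; positivity

lemma tendsto_cutRemainder (α : ℝ) {R : ℝ} (hR : 0 < R) :
    Tendsto (fun ε => cutRemainder α ε R) (𝓝[>] 0) (𝓝 0) := by
  refine tendsto_const_nhds.congr' ?_
  filter_upwards [Ioo_mem_nhdsGT hR] with ε hε
  rw [cutRemainder, if_neg hε.2.le.not_gt]

/-- The remainder compensates for the empty interval when `R < ε`, so one formula serves all `R`. -/
lemma mul_integral_Ioo_rpow {α ε R : ℝ} (hα : 0 < α) (hε : 0 < ε) :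
    α * ∫ r in Ioo ε R, (r ^ (α + 1))⁻¹ = (ε ^ α)⁻¹ - (R ^ α)⁻¹ + cutRemainder α ε R := by
  rcases lt_or_ge R ε with h | h
  · rw [Ioo_eq_empty_of_le h.le, cutRemainder, if_pos h]
    simp
  · have h1 : ∫ r in Ioo ε R, (r ^ (α + 1))⁻¹ = ∫ r in ε..R, r ^ (-(α + 1)) := by
      rw [intervalIntegral.integral_of_le h, integral_Ioc_eq_integral_Ioo]
      refine setIntegral_congr_fun measurableSet_Ioo fun r hr => ?_
      rw [Real.rpow_neg (hε.trans hr.1).le]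
    rw [h1, integral_rpow (Or.inr ⟨by linarith, fun h0 => ?_⟩), cutRemainder, if_neg h.not_gt,
      show -(α + 1) + 1 = -α by ring, Real.rpow_neg hε.le, Real.rpow_neg (hε.le.trans h)]
    · field_simp
      ring
    · rw [uIcc_of_le h] at h0
      exact absurd h0.1 hε.not_ge

lemma mul_integral_truncKernel_left {α ε a x t : ℝ} (hα : 0 < α) (hε : 0 < ε) (htx : t < x) :
    α * ∫ s in Ioo a x, truncKernel α ε (t - s) =
      (ε ^ α)⁻¹ - ((t - a) ^ α)⁻¹ + cutRemainder α ε (t - a) := by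
  rw [← mul_integral_Ioo_rpow hα hε, ← integral_indicator measurableSet_Ioo,
    ← integral_indicator measurableSet_Ioo, ← integral_sub_left_eq_self _ volume t]
  congr 2; ext s
  simp only [indicator, truncKernel, mem_Ioo, mem_Ioi, sub_sub_cancel]
  by_cases h : ε < s ∧ s < t - a
  · rw [if_pos h, if_pos ⟨by linarith [h.2], by linarith [h.1]⟩, if_pos h.1]
  · rw [if_neg h]
    split_ifs with h1 h2
    · exact absurd ⟨h2, by linarith [h1.1]⟩ h
    · rfl
    · rfl

lemma mul_integral_truncKernel_right {α ε a x s : ℝ} (hα : 0 < α) (hε : 0 < ε) (has : a < s) :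
    α * ∫ t in Ioo a x, truncKernel α ε (t - s) =
      (ε ^ α)⁻¹ - ((x - s) ^ α)⁻¹ + cutRemainder α ε (x - s) := by
  rw [← mul_integral_Ioo_rpow hα hε, ← integral_indicator measurableSet_Ioo,
    ← integral_indicator measurableSet_Ioo, ← integral_add_right_eq_self _ s]
  congr 2; ext t
  simp only [indicator, truncKernel, mem_Ioo, mem_Ioi, add_sub_cancel_right]
  by_cases h : ε < t ∧ t < x - s
  · rw [if_pos h, if_pos ⟨by linarith [h.1], by linarith [h.2]⟩, if_pos h.1]
  · rw [if_neg h]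
    split_ifs with h1 h2
    · exact absurd ⟨h2, by linarith [h1.2]⟩ h
    · rfl
    · rfl

/-- The difference quotient of the Weyl-Marchaud derivative, cut off near the diagonal. -/
noncomputable def diffQuot (α ε : ℝ) (f : ℝ → ℝ) (z : ℝ × ℝ) : ℝ :=
  (f z.1 - f z.2) * truncKernel α ε (z.1 - z.2)

/-- For `ε > 0` the truncated quotient is a restriction of the full one, which therefore dominates.
-/
lemma tendsto_integral_diffQuot {α : ℝ} {f : ℝ → ℝ} {μ : Measure (ℝ × ℝ)}
    (h : Integrable (diffQuot α 0 f) μ) :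
    Tendsto (fun ε => ∫ z, diffQuot α ε f z ∂μ) (𝓝[>] 0) (𝓝 (∫ z, diffQuot α 0 f z ∂μ)) := by
  have hS : ∀ ε : ℝ, MeasurableSet {z : ℝ × ℝ | ε < z.1 - z.2} := fun ε =>
    measurableSet_lt measurable_const (by fun_prop)
  have hK : ∀ ε > 0, diffQuot α ε f = indicator {z | ε < z.1 - z.2} (diffQuot α 0 f) := by
    intro ε hε
    ext z
    simp only [diffQuot, truncKernel, indicator, mem_Ioi, mem_ofPred_eq]
    split_ifs with h1 h2
    · rfl
    · exact absurd (hε.trans h1) h2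
    · simp
  refine tendsto_integral_filter_of_dominated_convergence (fun z => ‖diffQuot α 0 f z‖) ?_ ?_
    h.norm (Eventually.of_forall fun z => ?_)
  · filter_upwards [self_mem_nhdsWithin] with ε hε
    rw [hK ε hε]
    exact h.1.indicator (hS ε)
  · filter_upwards [self_mem_nhdsWithin] with ε hε
    refine Eventually.of_forall fun z => ?_
    rw [hK ε hε]
    exact norm_indicator_le_norm_self _ _
  · refine tendsto_const_nhds.congr' ?_
    rcases lt_or_ge 0 (z.1 - z.2) with hz | hz
    · filter_upwards [Ioo_mem_nhdsGT hz] with ε hε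
      rw [hK ε hε.1, indicator_of_mem (show z ∈ {z : ℝ × ℝ | ε < z.1 - z.2} from hε.2)]
    · filter_upwards [self_mem_nhdsWithin] with ε hε
      simp only [diffQuot, truncKernel, indicator, mem_Ioi]
      rw [if_neg hz.not_gt, if_neg (hz.trans (le_of_lt hε)).not_gt]

/-- Away from the diagonal the kernel is bounded, so `f t` and `f s` can be integrated separately,
each first in the other variable. The divergent terms `ε ^ (-α) ∫ f` cancel in the difference. -/
lemma mul_integral_diffQuot {α ε a x : ℝ} (hα : 0 < α) (hε : 0 < ε) {f : ℝ → ℝ}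
    (hf : Integrable f (leb a x)) (hfa : Integrable (fun t => f t / (t - a) ^ α) (leb a x))
    (hfx : Integrable (fun t => f t / (x - t) ^ α) (leb a x)) :
    α * ∫ z, diffQuot α ε f z ∂((leb a x).prod (leb a x)) =
      (∫ t in Ioo a x, f t / (x - t) ^ α) - (∫ t in Ioo a x, f t / (t - a) ^ α) +
        ∫ t in Ioo a x, f t * (cutRemainder α ε (t - a) - cutRemainder α ε (x - t)) := by
  have hm : AEStronglyMeasurable (fun z : ℝ × ℝ => truncKernel α ε (z.1 - z.2))
      ((leb a x).prod (leb a x)) :=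
    ((measurable_truncKernel α ε).comp (by fun_prop)).aestronglyMeasurable
  have hb : ∀ᵐ z ∂((leb a x).prod (leb a x)),
      ‖(fun z : ℝ × ℝ => truncKernel α ε (z.1 - z.2)) z‖ ≤ (ε ^ (α + 1))⁻¹ :=
    Eventually.of_forall fun z => abs_truncKernel_le hα hε _
  have i1 : Integrable (fun z : ℝ × ℝ => f z.1 * truncKernel α ε (z.1 - z.2))
      ((leb a x).prod (leb a x)) := (hf.comp_fst (leb a x)).mul_bdd (c := (ε ^ (α + 1))⁻¹) hm hb
  have i2 : Integrable (fun z : ℝ × ℝ => f z.2 * truncKernel α ε (z.1 - z.2))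
      ((leb a x).prod (leb a x)) := (hf.comp_snd (leb a x)).mul_bdd (c := (ε ^ (α + 1))⁻¹) hm hb
  have e1 : α * ∫ z, f z.1 * truncKernel α ε (z.1 - z.2) ∂((leb a x).prod (leb a x)) =
      ∫ t in Ioo a x,
        f t * ((ε ^ α)⁻¹ - ((t - a) ^ α)⁻¹ + cutRemainder α ε (t - a)) := by
    rw [integral_prod _ i1, ← integral_const_mul]
    refine setIntegral_congr_fun measurableSet_Ioo fun t ht => ?_
    simp only
    rw [integral_const_mul, ← mul_integral_truncKernel_left hα hε ht.2]
    ring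
  have e2 : α * ∫ z, f z.2 * truncKernel α ε (z.1 - z.2) ∂((leb a x).prod (leb a x)) =
      ∫ t in Ioo a x,
        f t * ((ε ^ α)⁻¹ - ((x - t) ^ α)⁻¹ + cutRemainder α ε (x - t)) := by
    rw [integral_prod_symm _ i2, ← integral_const_mul]
    refine setIntegral_congr_fun measurableSet_Ioo fun t ht => ?_
    simp only
    rw [integral_const_mul, ← mul_integral_truncKernel_right hα hε ht.1]
    ring
  have j1 : Integrable (fun t => f t * cutRemainder α ε (t - a)) (leb a x) := by
    refine hfa.mono (hf.1.mul
      ((measurable_cutRemainder α ε).comp (by fun_prop)).aestronglyMeasurable) ?_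
    refine (ae_restrict_iff' measurableSet_Ioo).2 (Eventually.of_forall fun t ht => ?_)
    have h0 : 0 < t - a := by linarith [ht.1]
    rw [div_eq_mul_inv, norm_mul, norm_mul, Real.norm_of_nonneg (r := (_)⁻¹) (by positivity)]
    exact mul_le_mul_of_nonneg_left (abs_cutRemainder_le hα h0) (norm_nonneg _)
  have j2 : Integrable (fun t => f t * cutRemainder α ε (x - t)) (leb a x) := by
    refine hfx.mono (hf.1.mul
      ((measurable_cutRemainder α ε).comp (by fun_prop)).aestronglyMeasurable) ?_
    refine (ae_restrict_iff' measurableSet_Ioo).2 (Eventually.of_forall fun t ht => ?_)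
    have h0 : 0 < x - t := by linarith [ht.2]
    rw [div_eq_mul_inv, norm_mul, norm_mul, Real.norm_of_nonneg (r := (_)⁻¹) (by positivity)]
    exact mul_le_mul_of_nonneg_left (abs_cutRemainder_le hα h0) (norm_nonneg _)
  simp only [diffQuot, sub_mul]
  rw [integral_sub i1 i2, mul_sub, e1, e2, ← integral_sub, ← integral_sub hfx hfa, ← integral_add]
  · congr 1; ext t
    ring
  · exact hfx.sub hfa
  · convert! j1.sub j2 using 1
    ext t; simp only [Pi.sub_apply]; ring
  · convert! ((hf.mul_const (ε ^ α)⁻¹).sub hfa).add j1 using 1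
    ext t; simp only [Pi.sub_apply, Pi.add_apply]; ring
  · convert! ((hf.mul_const (ε ^ α)⁻¹).sub hfx).add j2 using 1
    ext t; simp only [Pi.sub_apply, Pi.add_apply]; ring

/-- Up to the factor `1 / Γ(1-α)` this is `I^1 D^α f = I^(1-α) f` at `x`. It is the limit `ε → 0` of
the truncated identity; the remainders are dominated by `(t - a)^(-α)` and `(x - t)^(-α)`. -/
lemma integral_add_mul_integral_diffQuot {α a x : ℝ} (hα : 0 < α) {f : ℝ → ℝ}
    (hf : Integrable f (leb a x)) (hfa : Integrable (fun t => f t / (t - a) ^ α) (leb a x))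
    (hfx : Integrable (fun t => f t / (x - t) ^ α) (leb a x))
    (hK : Integrable (diffQuot α 0 f) ((leb a x).prod (leb a x))) :
    (∫ t in Ioo a x, f t / (t - a) ^ α) +
      α * ∫ z, diffQuot α 0 f z ∂((leb a x).prod (leb a x)) =
        ∫ t in Ioo a x, f t / (x - t) ^ α := by
  have h1 := (tendsto_integral_diffQuot hK).const_mul α
  have h2 : Tendsto (fun ε => ∫ t in Ioo a x,
      f t * (cutRemainder α ε (t - a) - cutRemainder α ε (x - t))) (𝓝[>] 0)
      (𝓝 (∫ t in Ioo a x, f t * (0 - 0))) := by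
    refine tendsto_integral_filter_of_dominated_convergence
      (fun t => ‖f t / (t - a) ^ α‖ + ‖f t / (x - t) ^ α‖) ?_ ?_ (hfa.norm.add hfx.norm) ?_
    · refine Eventually.of_forall fun ε => hf.1.mul (Measurable.aestronglyMeasurable ?_)
      exact ((measurable_cutRemainder α ε).comp (by fun_prop)).sub
        ((measurable_cutRemainder α ε).comp (by fun_prop))
    · refine Eventually.of_forall fun ε => ?_
      refine (ae_restrict_iff' measurableSet_Ioo).2 (Eventually.of_forall fun t ht => ?_)
      have h0 : 0 < t - a := by linarith [ht.1]
      have h0' : 0 < x - t := by linarith [ht.2]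
      rw [div_eq_mul_inv, div_eq_mul_inv, norm_mul, norm_mul, norm_mul, ← mul_add,
        Real.norm_of_nonneg (r := ((t - a) ^ α)⁻¹) (by positivity),
        Real.norm_of_nonneg (r := ((x - t) ^ α)⁻¹) (by positivity)]
      refine mul_le_mul_of_nonneg_left ?_ (norm_nonneg _)
      exact (norm_sub_le _ _).trans
        (add_le_add (abs_cutRemainder_le hα h0) (abs_cutRemainder_le hα h0'))
    · refine (ae_restrict_iff' measurableSet_Ioo).2 (Eventually.of_forall fun t ht => ?_)
      exact ((tendsto_cutRemainder α (by linarith [ht.1])).sub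
        (tendsto_cutRemainder α (by linarith [ht.2]))).const_mul _
  have h3 := (h2.const_add
    ((∫ t in Ioo a x, f t / (x - t) ^ α) - (∫ t in Ioo a x, f t / (t - a) ^ α)))
  have h4 := tendsto_nhds_unique (h1.congr' ?_) h3
  · rw [h4]
    simp
  · filter_upwards [self_mem_nhdsWithin] with ε hε
    exact mul_integral_diffQuot hα hε hf hfa hfx

/-! ### Functions of finite `W^α_1(a+)` norm and the inversion formula -/

section
variable {a b α : ℝ} {f : ℝ → ℝ}

lemma integrable_div_of_normW1 (hf : AEMeasurable f (leb a b)) (h : normW1 a b α f < ∞) :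
    Integrable (fun t => f t / (t - a) ^ α) (leb a b) := by
  refine ⟨(hf.div (by fun_prop)).aestronglyMeasurable, ?_⟩
  refine lt_of_le_of_lt ?_ ((le_add_right le_rfl).trans_lt h)
  refine (setLIntegral_congr_fun measurableSet_Ioo fun t ht => ?_).le
  have h0 : 0 < t - a := by linarith [ht.1]
  simp only
  rw [← ofReal_norm, norm_div, Real.norm_eq_abs,
    Real.norm_of_nonneg (r := (t - a) ^ α) (by positivity)]

lemma integrable_of_normW1 (hα : 0 < α) (hf : AEMeasurable f (leb a b))
    (h : normW1 a b α f < ∞) : Integrable f (leb a b) := by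
  refine ((integrable_div_of_normW1 hf h).norm.const_mul ((b - a) ^ α)).mono'
    hf.aestronglyMeasurable ?_
  refine (ae_restrict_iff' measurableSet_Ioo).2 (Eventually.of_forall fun t ht => ?_)
  have h0 : 0 < t - a := by linarith [ht.1]
  have h1 : (t - a) ^ α ≤ (b - a) ^ α := by gcongr; linarith [ht.2]
  have h2 : 0 < (t - a) ^ α := by positivity
  rw [norm_div, Real.norm_of_nonneg (r := (t - a) ^ α) h2.le, mul_div_assoc', le_div_iff₀ h2,
    mul_comm]
  gcongr

lemma aestronglyMeasurable_diffQuot (ε : ℝ) (hf : AEMeasurable f (leb a b)) :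
    AEStronglyMeasurable (diffQuot α ε f) ((leb a b).prod (leb a b)) :=
  (hf.aestronglyMeasurable.comp_fst.sub hf.aestronglyMeasurable.comp_snd).mul
    ((measurable_truncKernel α ε).comp (by fun_prop)).aestronglyMeasurable

lemma diffQuot_zero_of_lt {t s : ℝ} (h : s < t) :
    diffQuot α 0 f (t, s) = (f t - f s) / (t - s) ^ (α + 1) := by
  rw [diffQuot, truncKernel, indicator_of_mem (show t - s ∈ Ioi 0 from sub_pos.2 h), div_eq_mul_inv]

lemma diffQuot_zero_of_le {t s : ℝ} (h : t ≤ s) : diffQuot α 0 f (t, s) = 0 := by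
  have h' : t - s ∉ Ioi 0 := fun h' => (sub_pos.1 h').not_ge h
  rw [diffQuot, truncKernel, indicator_of_notMem h', mul_zero]

lemma diffQuot_eq_indicator {x t : ℝ} (htx : t ≤ x) :
    indicator (Ioo a x) (fun s => diffQuot α 0 f (t, s)) =
      indicator (Ioo a t) fun s => (f t - f s) / (t - s) ^ (α + 1) := by
  ext s
  by_cases hs : s ∈ Ioo a t
  · rw [indicator_of_mem hs, indicator_of_mem (show s ∈ Ioo a x from ⟨hs.1, hs.2.trans_le htx⟩), diffQuot_zero_of_lt hs.2]
  · rw [indicator_of_notMem hs]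
    by_cases h : s ∈ Ioo a x
    · rw [indicator_of_mem h, diffQuot_zero_of_le]
      by_contra! h'
      exact hs ⟨h.1, h'⟩
    · rw [indicator_of_notMem h]

lemma lintegral_diffQuot {t : ℝ} (ht : t ∈ Ioo a b) :
    ∫⁻ s in Ioo a b, ‖diffQuot α 0 f (t, s)‖ₑ =
      ∫⁻ s in Ioo a t, ENNReal.ofReal (|f t - f s| / |t - s| ^ (1 + α)) := by
  rw [← lintegral_indicator measurableSet_Ioo, ← lintegral_indicator measurableSet_Ioo]
  congr 1; ext s
  have h := congr_fun (diffQuot_eq_indicator (a := a) (α := α) (f := f) ht.2.le) s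
  by_cases hs : s ∈ Ioo a t
  · have h0 : 0 < t - s := by linarith [hs.2]
    rw [indicator_of_mem hs, indicator_of_mem (show s ∈ Ioo a b from ⟨hs.1, hs.2.trans ht.2⟩), diffQuot_zero_of_lt hs.2,
      ← ofReal_norm, norm_div, Real.norm_eq_abs,
      Real.norm_of_nonneg (r := (t - s) ^ (α + 1)) (by positivity), abs_of_pos h0, add_comm 1 α]
  · rw [indicator_of_notMem hs]
    by_cases h' : s ∈ Ioo a b
    · rw [indicator_of_mem h', diffQuot_zero_of_le, enorm_zero]
      by_contra! h2
      exact hs ⟨h'.1, h2⟩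
    · rw [indicator_of_notMem h']

lemma integrable_diffQuot_of_normW1 (hf : AEMeasurable f (leb a b)) (h : normW1 a b α f < ∞) :
    Integrable (diffQuot α 0 f) ((leb a b).prod (leb a b)) := by
  have hm := aestronglyMeasurable_diffQuot (α := α) 0 hf
  refine ⟨hm, ?_⟩
  rw [HasFiniteIntegral, lintegral_prod _ hm.enorm]
  refine lt_of_le_of_lt ?_ ((le_add_left le_rfl).trans_lt h)
  exact (setLIntegral_congr_fun measurableSet_Ioo fun t ht => lintegral_diffQuot ht).le

/-- Makes the inner domain independent of `t`, so that Fubini can be used on a square. -/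
lemma leftD_eq {x t : ℝ} (htx : t ≤ x) : leftD a α f t = (Real.Gamma (1 - α))⁻¹ *
    (f t / (t - a) ^ α + α * ∫ s in Ioo a x, diffQuot α 0 f (t, s)) := by
  rw [leftD, ← integral_indicator measurableSet_Ioo, ← diffQuot_eq_indicator htx,
    integral_indicator measurableSet_Ioo]

lemma integrable_leftD (hf : AEMeasurable f (leb a b)) (h : normW1 a b α f < ∞) :
    Integrable (leftD a α f) (leb a b) := by
  have h1 := (((integrable_div_of_normW1 hf h).add
    ((integrable_diffQuot_of_normW1 hf h).integral_prod_left.const_mul α)).const_mul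
    (Real.Gamma (1 - α))⁻¹)
  refine h1.congr ((ae_restrict_iff' measurableSet_Ioo).2 (Eventually.of_forall fun t ht => ?_))
  simp only [Pi.add_apply]
  rw [leftD_eq ht.2.le]

lemma ae_integrableOn_leftD (hf : AEMeasurable f (leb a b)) (h : normW1 a b α f < ∞) :
    ∀ᵐ t ∂(leb a b), IntegrableOn (fun s => (f t - f s) / (t - s) ^ (α + 1)) (Ioo a t) := by
  filter_upwards [(integrable_diffQuot_of_normW1 hf h).prod_right_ae,
    ae_restrict_mem measurableSet_Ioo] with t h1 ht
  rwa [← IntegrableOn, ← integrable_indicator_iff measurableSet_Ioo, diffQuot_eq_indicator ht.2.le,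
    integrable_indicator_iff measurableSet_Ioo] at h1

/-- A function of finite `W^α_1(a+)` norm is the Riemann-Liouville integral of its Weyl-Marchaud
derivative. -/
lemma ae_eq_leftRL_leftD (hα : α ∈ Ioo (0 : ℝ) 1) (hf : AEMeasurable f (leb a b))
    (h : normW1 a b α f < ∞) : f =ᵐ[leb a b] leftRL a α (leftD a α f) := by
  have hL : b ≤ a + (b - a) := by linarith
  have hD := memLp_one_iff_integrable.2 (integrable_leftD hf h)
  have hfi := integrable_of_normW1 hα.1 hf h
  have hfa := integrable_div_of_normW1 hf h
  have hK := integrable_diffQuot_of_normW1 hf h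
  have iu := integrable_leftExt (memLp_one_iff_integrable.2 hfi)
  have iD := integrable_leftExt hD
  have zu : ∀ φ : ℝ → ℝ, ∀ x ≤ a, leftExt a b φ x = 0 := fun φ x hx => leftExt_of_le φ hx
  have h1α : 0 < 1 - α := sub_pos.2 hα.2
  rw [ae_eq_leftRL_iff hα.1.le]
  -- It suffices to compare after applying `I^(1-α)`, which turns `I^α D^α f` into the primitive of
  -- `D^α f`.
  refine ae_eq_of_fracInt_ae_eq h1α.le (by linarith [hα.1]) hL iu (integrable_fracInt _ hα.1.le iD)
    (zu f) (fun x hx => fracInt_of_le _ _ (zu _) hx) ?_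
  filter_upwards [fracInt_fracInt h1α.le hα.1.le hL iD (zu _),
    ae_integrable_conv_integrand iu (integrable_rlKernel (b - a) h1α)] with x hx hxi hxb
  rw [hx hxb, sub_add_cancel, fracInt_one hL (zu _) hxb]
  rcases le_or_gt x a with hxa | hxa
  · rw [fracInt_of_le _ _ (zu f) hxa, intervalIntegral.integral_of_ge hxa,
      setIntegral_eq_zero_of_forall_eq_zero fun s hs => zu _ s hs.2, neg_zero]
  have hsub : Ioo a x ⊆ Ioo a b := Ioo_subset_Ioo_right hxb.le
  have hle : leb a x ≤ leb a b := Measure.restrict_mono hsub le_rfl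
  have hΓ : Real.Gamma (1 - α) ≠ 0 := (Real.Gamma_pos_of_pos h1α).ne'
  -- Holds only for a.e. `x`, as existence of a convolution of integrable functions.
  have hfx : Integrable (fun t => f t / (x - t) ^ α) (leb a x) := by
    have h2 := ((hxi.integrableOn (s := Ioo a x)).re).mul_const (Real.Gamma (1 - α))
    refine h2.congr ((ae_restrict_iff' measurableSet_Ioo).2 (Eventually.of_forall fun t ht => ?_))
    simp only
    rw [leftExt_of_mem f (hsub ht), rlKernel_of_mem ⟨by linarith [ht.2], by linarith [ht.1]⟩,
      ← Complex.ofReal_mul, RCLike.re_eq_complex_re, Complex.ofReal_re, show 1 - α - 1 = -α by ring,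
      Real.rpow_neg (by linarith [ht.2])]
    field_simp
  have hKx : Integrable (diffQuot α 0 f) ((leb a x).prod (leb a x)) :=
    hK.mono_measure (Measure.prod_mono hle hle)
  have key := integral_add_mul_integral_diffQuot hα.1 (hfi.mono_measure hle)
    (hfa.mono_measure hle) hfx hKx
  have e1 : ∫ t in Ioo a x, leftD a α f t =
      (Real.Gamma (1 - α))⁻¹ * ∫ t in Ioo a x, f t / (x - t) ^ α := by
    rw [← key, integral_prod _ hKx, ← integral_const_mul, ← integral_add (hfa.mono_measure hle)
      (hKx.integral_prod_left.const_mul α), ← integral_const_mul]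
    exact setIntegral_congr_fun measurableSet_Ioo fun t ht => leftD_eq ht.2.le
  rw [← leftRL_eq_fracInt h1α.le f ⟨hxa, hxb⟩, leftRL, if_neg h1α.ne',
    intervalIntegral.integral_of_le hxa.le, integral_Ioc_eq_integral_Ioo, sub_sub_cancel, ← e1,
    ← integral_complex_ofReal]
  exact setIntegral_congr_fun measurableSet_Ioo fun t ht => (leftExt_of_mem _ (hsub ht)).symm

end

/-! ### Estimates for the left derivative -/

section
variable {a b α : ℝ} {f : ℝ → ℝ}

lemma integral_abs_leftD_le (hα : α ∈ Ioo (0 : ℝ) 1) (hf : AEMeasurable f (leb a b))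
    (h : normW1 a b α f < ∞) :
    ∫ t in Ioo a b, |leftD a α f t| ≤ (Real.Gamma (1 - α))⁻¹ * (normW1 a b α f).toReal := by
  have hfa := integrable_div_of_normW1 hf h
  have hK := integrable_diffQuot_of_normW1 hf h
  have hΓ : 0 < Real.Gamma (1 - α) := Real.Gamma_pos_of_pos (sub_pos.2 hα.2)
  have e1 : ∫ t in Ioo a b, ‖f t / (t - a) ^ α‖ =
      (∫⁻ t in Ioo a b, ENNReal.ofReal (|f t| / (t - a) ^ α)).toReal := by
    rw [integral_norm_eq_lintegral_enorm hfa.1]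
    congr 1
    refine setLIntegral_congr_fun measurableSet_Ioo fun t ht => ?_
    have h0 : 0 < t - a := by linarith [ht.1]
    rw [← ofReal_norm, norm_div, Real.norm_eq_abs,
      Real.norm_of_nonneg (r := (t - a) ^ α) (by positivity)]
  have e2 : ∫ t in Ioo a b, ∫ s in Ioo a b, ‖diffQuot α 0 f (t, s)‖ =
      (∫⁻ t in Ioo a b, ∫⁻ s in Ioo a t,
        ENNReal.ofReal (|f t - f s| / |t - s| ^ (1 + α))).toReal := by
    rw [← integral_prod _ hK.norm, integral_norm_eq_lintegral_enorm hK.1,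
      lintegral_prod _ hK.1.enorm]
    congr 1
    exact setLIntegral_congr_fun measurableSet_Ioo fun t ht => lintegral_diffQuot ht
  have hfin := ENNReal.add_lt_top.1 (show _ + _ < ∞ from h)
  rw [normW1, ENNReal.toReal_add hfin.1.ne hfin.2.ne, ← e1, ← e2, ← integral_add hfa.norm
    hK.norm.integral_prod_left, ← integral_const_mul]
  refine setIntegral_mono_on (integrable_leftD hf h).norm ((hfa.norm.add
    hK.norm.integral_prod_left).const_mul _) measurableSet_Ioo fun t ht => ?_
  rw [leftD_eq ht.2.le, abs_mul, abs_of_pos (inv_pos.2 hΓ)]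
  refine mul_le_mul_of_nonneg_left ((abs_add_le _ _).trans (add_le_add le_rfl ?_)) (by positivity)
  rw [abs_mul, abs_of_pos hα.1]
  exact (mul_le_of_le_one_left (abs_nonneg _) hα.2.le).trans
    (norm_integral_le_integral_norm fun s => diffQuot α 0 f (t, s))

lemma leftD_sub_const (c t : ℝ) : leftD a α (fun s => f s - c) t =
    leftD a α f t - c * ((Real.Gamma (1 - α))⁻¹ * ((t - a) ^ α)⁻¹) := by
  simp only [leftD, sub_sub_sub_cancel_right]
  ring

lemma integrable_inv_rpow (hα : α < 1) : Integrable (fun t => ((t - a) ^ α)⁻¹) (leb a b) := by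
  rcases le_or_gt b a with h | h
  · simp [leb, Ioo_eq_empty_of_le h]
  have h1 := (intervalIntegral.intervalIntegrable_rpow' (a := a - a) (b := b - a) (r := -α)
    (by linarith)).comp_sub_right a
  rw [sub_add_cancel, sub_add_cancel, intervalIntegrable_iff_integrableOn_Ioo_of_le h.le] at h1
  refine h1.congr ((ae_restrict_iff' measurableSet_Ioo).2 (Eventually.of_forall fun t ht => ?_))
  simp only
  rw [Real.rpow_neg (by linarith [ht.1])]

/-- Differences ignore the constant, and `(t - a)^(-α)` is integrable because `α < 1`. -/
lemma normW1_sub_const_lt_top (hα : α < 1) (h : normW1 a b α f < ∞) (c : ℝ) :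
    normW1 a b α (fun t => f t - c) < ∞ := by
  obtain ⟨h1, h2⟩ := ENNReal.add_lt_top.1 (show _ + _ < ∞ from h)
  simp only [normW1, sub_sub_sub_cancel_right]
  refine ENNReal.add_lt_top.2 ⟨?_, h2⟩
  have h3 := ((integrable_inv_rpow (a := a) (b := b) hα).const_mul |c|)
  refine lt_of_le_of_lt ?_ (ENNReal.add_lt_top.2 ⟨h1, h3.2⟩)
  rw [← lintegral_add_right' _ h3.1.enorm]
  refine setLIntegral_mono' measurableSet_Ioo fun t ht => ?_
  have h0 : 0 < t - a := by linarith [ht.1]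
  have h4 : 0 < (t - a) ^ α := by positivity
  rw [← ofReal_norm, ← ENNReal.ofReal_add (by positivity) (norm_nonneg _),
    Real.norm_of_nonneg (by positivity), ← div_eq_mul_inv, ← add_div]
  exact ENNReal.ofReal_le_ofReal (by gcongr; exact abs_sub _ _)

end

/-! ### Reflection -/

lemma setIntegral_Ioo_comp_neg {E : Type*} [NormedAddCommGroup E] [NormedSpace ℝ E] (t b : ℝ)
    (h : ℝ → E) : ∫ s in Ioo (-b) (-t), h (-s) = ∫ s in Ioo t b, h s := by
  have := (Measure.measurePreserving_neg (volume : Measure ℝ)).setIntegral_preimage_emb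
    (MeasurableEquiv.neg ℝ).measurableEmbedding h (Ioo t b)
  rwa [neg_preimage, Set.neg_Ioo] at this

lemma setLIntegral_Ioo_comp_neg (t b : ℝ) (h : ℝ → ℝ≥0∞) :
    ∫⁻ s in Ioo (-b) (-t), h (-s) = ∫⁻ s in Ioo t b, h s := by
  have := (Measure.measurePreserving_neg (volume : Measure ℝ)).setLIntegral_comp_preimage_emb
    (MeasurableEquiv.neg ℝ).measurableEmbedding h (Ioo t b)
  rwa [neg_preimage, Set.neg_Ioo] at this

lemma measurePreserving_neg_leb (a b : ℝ) :
    MeasurePreserving (fun x : ℝ => -x) (leb (-b) (-a)) (leb a b) := by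
  have := (Measure.measurePreserving_neg (volume : Measure ℝ)).restrict_preimage_emb
    (MeasurableEquiv.neg ℝ).measurableEmbedding (Ioo a b)
  rwa [neg_preimage, Set.neg_Ioo] at this

lemma measurePreserving_neg_leb' (a b : ℝ) :
    MeasurePreserving (fun x : ℝ => -x) (leb a b) (leb (-b) (-a)) := by
  simpa using measurePreserving_neg_leb (-b) (-a)

lemma rightD_eq_leftD (b β : ℝ) (g : ℝ → ℝ) (t : ℝ) :
    rightD b β g t = (-1 : ℂ) ^ (β : ℂ) * (leftD (-b) β (fun x => g (-x)) (-t) : ℂ) := by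
  have h := setIntegral_Ioo_comp_neg t b fun s => (g t - g s) / (s - t) ^ (β + 1)
  have h2 : ∀ s, -t - s = -s - t := fun s => by ring
  rw [rightD, leftD, ← h]
  simp only [neg_neg, h2]
  push_cast
  ring

/-- The phases `(-1) ^ β` and `(-1) ^ (-β)` cancel, which reduces inversion on the right to
inversion on the left. -/
lemma rightRL_rightD {b β : ℝ} (hβ : 0 < β) (g : ℝ → ℝ) (t : ℝ) :
    rightRL b β (rightD b β g) t =
      (leftRL (-b) β (leftD (-b) β fun x => g (-x)) (-t) : ℂ) := by
  rw [rightRL, if_neg hβ.ne', leftRL, if_neg hβ.ne', ← setIntegral_Ioo_comp_neg]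
  have h : ∀ s, rightD b β g (-s) / (((-s - t) ^ (1 - β) : ℝ) : ℂ) = (-1 : ℂ) ^ (β : ℂ) *
      ((leftD (-b) β (fun x => g (-x)) s / (-t - s) ^ (1 - β) : ℝ) : ℂ) := fun s => by
    rw [rightD_eq_leftD, neg_neg, show -s - t = -t - s by ring]
    push_cast
    ring
  simp only [h]
  rw [integral_const_mul, integral_complex_ofReal, div_mul_eq_mul_div, ← mul_assoc,
    mul_comm ((-1 : ℂ) ^ (-β : ℂ)), neg_one_cpow_neg_mul]
  push_cast
  ring

/-! ### The right derivative of functions of finite `W^β_∞(b-)` norm -/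

section
variable {a b β : ℝ} {g : ℝ → ℝ}

lemma ofReal_abs_div_le_normWInf {t : ℝ} (ht : t ∈ Ioo a b) :
    ENNReal.ofReal (|g t - Function.leftLim g b| / (b - t) ^ β) +
      ∫⁻ s in Ioo t b, ENNReal.ofReal (|g t - g s| / |t - s| ^ (1 + β)) ≤ normWInf a b β g := by
  rw [abs_sub_comm]
  exact add_le_add
    (le_iSup₂ (f := fun t (_ : t ∈ Ioo a b) =>
      ENNReal.ofReal (|Function.leftLim g b - g t| / (b - t) ^ β)) t ht)
    (le_iSup₂ (f := fun t (_ : t ∈ Ioo a b) =>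
      ∫⁻ s in Ioo t b, ENNReal.ofReal (|g t - g s| / |t - s| ^ (1 + β))) t ht)

lemma integrableOn_of_normWInf (hg : AEMeasurable g (leb a b)) (h : normWInf a b β g < ∞) {t : ℝ}
    (ht : t ∈ Ioo a b) : IntegrableOn (fun s => (g t - g s) / (s - t) ^ (β + 1)) (Ioo t b) := by
  have hm : AEMeasurable g (volume.restrict (Ioo t b)) :=
    hg.mono_measure (Measure.restrict_mono (Ioo_subset_Ioo_left ht.1.le) le_rfl)
  refine ⟨((hm.const_sub _).div (by fun_prop)).aestronglyMeasurable, ?_⟩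
  refine lt_of_le_of_lt ?_ (((le_add_left le_rfl).trans (ofReal_abs_div_le_normWInf ht)).trans_lt h)
  refine (setLIntegral_congr_fun measurableSet_Ioo fun s hs => ?_).le
  have h0 : 0 < s - t := by linarith [hs.1]
  simp only
  rw [← ofReal_norm, norm_div, Real.norm_eq_abs, abs_sub_comm t s, abs_of_pos h0,
    Real.norm_of_nonneg (r := (s - t) ^ (β + 1)) (by positivity), add_comm 1 β]

lemma abs_div_add_integral_le (hg : AEMeasurable g (leb a b)) (h : normWInf a b β g < ∞) {t : ℝ}
    (ht : t ∈ Ioo a b) : |g t - Function.leftLim g b| / (b - t) ^ β +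
      ∫ s in Ioo t b, |(g t - g s) / (s - t) ^ (β + 1)| ≤ (normWInf a b β g).toReal := by
  have h1 := ofReal_abs_div_le_normWInf (g := g) (β := β) ht
  have h0 : 0 < b - t := by linarith [ht.2]
  have h2 : ∫ s in Ioo t b, ‖(g t - g s) / (s - t) ^ (β + 1)‖ =
      (∫⁻ s in Ioo t b, ENNReal.ofReal (|g t - g s| / |t - s| ^ (1 + β))).toReal := by
    rw [integral_norm_eq_lintegral_enorm (integrableOn_of_normWInf hg h ht).1]
    congr 1
    refine setLIntegral_congr_fun measurableSet_Ioo fun s hs => ?_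
    have h0 : 0 < s - t := by linarith [hs.1]
    rw [← ofReal_norm, norm_div, Real.norm_eq_abs, abs_sub_comm t s, abs_of_pos h0,
      Real.norm_of_nonneg (r := (s - t) ^ (β + 1)) (by positivity), add_comm 1 β]
  simp only [Real.norm_eq_abs] at h2
  have h3 := ENNReal.add_lt_top.1 (h1.trans_lt h)
  rw [h2, ← ENNReal.toReal_ofReal (r := |g t - Function.leftLim g b| / (b - t) ^ β) (by positivity),
    ← ENNReal.toReal_add h3.1.ne h3.2.ne]
  exact ENNReal.toReal_mono h.ne h1

/-- On a bounded interval suprema dominate integrals, so the inversion formula for `W^β_1` applies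
to the reflection of `g - g(b-)`. -/
lemma normW1_reflect_lt_top (h : normWInf a b β g < ∞) :
    normW1 (-b) (-a) β (fun x => g (-x) - Function.leftLim g b) < ∞ := by
  have hfin : ∫⁻ _ in Ioo (-b) (-a), normWInf a b β g < ∞ := by
    rw [setLIntegral_const]
    exact ENNReal.mul_lt_top h (by simp)
  refine ENNReal.add_lt_top.2 ⟨lt_of_le_of_lt (setLIntegral_mono' measurableSet_Ioo
    fun x hx => ?_) hfin, lt_of_le_of_lt (setLIntegral_mono' measurableSet_Ioo
    fun x hx => ?_) hfin⟩
  all_goals have hm : -x ∈ Ioo a b := ⟨by linarith [hx.2], by linarith [hx.1]⟩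
  · have := (le_add_right le_rfl).trans (ofReal_abs_div_le_normWInf (g := g) (β := β) hm)
    rwa [show x - -b = b - -x by ring]
  · have := (le_add_left le_rfl).trans (ofReal_abs_div_le_normWInf (g := g) (β := β) hm)
    rw [← setLIntegral_Ioo_comp_neg, neg_neg] at this
    refine le_trans (le_of_eq ?_) this
    congr 1; ext s
    rw [sub_sub_sub_cancel_right, show -x - -s = -(x - s) by ring, abs_neg]

lemma aemeasurable_reflect (hg : AEMeasurable g (leb a b)) (c : ℝ) :
    AEMeasurable (fun x => g (-x) - c) (leb (-b) (-a)) :=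
  (hg.comp_quasiMeasurePreserving (measurePreserving_neg_leb a b).quasiMeasurePreserving).sub_const c

/-- The real factor of the right Weyl-Marchaud derivative of `g - g(b-)`. -/
noncomputable def rightDReal (b β : ℝ) (g : ℝ → ℝ) (t : ℝ) : ℝ :=
  leftD (-b) β (fun x => g (-x) - Function.leftLim g b) (-t)

lemma rightD_eq (b β : ℝ) (g : ℝ → ℝ) (t : ℝ) :
    rightD b β (fun s => g s - Function.leftLim g b) t =
      (-1 : ℂ) ^ (β : ℂ) * (rightDReal b β g t : ℂ) := rightD_eq_leftD _ _ _ _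

lemma aestronglyMeasurable_rightDReal (hg : AEMeasurable g (leb a b)) (h : normWInf a b β g < ∞) :
    AEStronglyMeasurable (rightDReal b β g) (leb a b) :=
  (integrable_leftD (aemeasurable_reflect hg _) (normW1_reflect_lt_top h)).1.comp_measurePreserving
    (measurePreserving_neg_leb' a b)

lemma abs_rightDReal_le (hβ : β ∈ Ioo (0 : ℝ) 1) (hg : AEMeasurable g (leb a b))
    (h : normWInf a b β g < ∞) {t : ℝ} (ht : t ∈ Ioo a b) :
    |rightDReal b β g t| ≤ (normWInf a b β g).toReal / Real.Gamma (1 - β) := by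
  have hΓ : 0 < Real.Gamma (1 - β) := Real.Gamma_pos_of_pos (sub_pos.2 hβ.2)
  have h0 : 0 < b - t := by linarith [ht.2]
  have h1 : rightDReal b β g t = (Real.Gamma (1 - β))⁻¹ *
      ((g t - Function.leftLim g b) / (b - t) ^ β +
        β * ∫ s in Ioo t b, (g t - g s) / (s - t) ^ (β + 1)) := by
    rw [rightDReal, leftD, ← setIntegral_Ioo_comp_neg]
    simp only [neg_neg, sub_sub_sub_cancel_right, show -t - -b = b - t by ring]
    simp only [show ∀ s, -t - s = -s - t from fun s => by ring, neg_neg]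
  rw [h1, abs_mul, abs_of_pos (inv_pos.2 hΓ), div_eq_inv_mul (normWInf a b β g).toReal]
  refine mul_le_mul_of_nonneg_left (le_trans ?_ (abs_div_add_integral_le hg h ht)) (by positivity)
  refine (abs_add_le _ _).trans (add_le_add (le_of_eq ?_) ?_)
  · rw [abs_div, abs_of_pos (a := (b - t) ^ β) (by positivity)]
  · rw [abs_mul, abs_of_pos hβ.1]
    exact (mul_le_of_le_one_left (abs_nonneg _) hβ.2.le).trans abs_integral_le_integral_abs

lemma memLp_top_rightD (hβ : β ∈ Ioo (0 : ℝ) 1) (hg : AEMeasurable g (leb a b))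
    (h : normWInf a b β g < ∞) :
    MemLp (rightD b β fun s => g s - Function.leftLim g b) ∞ (leb a b) := by
  have h1 : MemLp (rightDReal b β g) ∞ (leb a b) :=
    memLp_top_of_bound (aestronglyMeasurable_rightDReal hg h) _
      ((ae_restrict_iff' measurableSet_Ioo).2 (Eventually.of_forall fun t ht =>
        abs_rightDReal_le hβ hg h ht))
  exact (h1.ofReal.const_mul ((-1 : ℂ) ^ (β : ℂ))).ae_eq
    (Eventually.of_forall fun t => (rightD_eq b β g t).symm)

lemma isRightRLDeriv_rightD (hβ : β ∈ Ioo (0 : ℝ) 1) (hg : AEMeasurable g (leb a b))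
    (h : normWInf a b β g < ∞) : IsRightRLDeriv a b β (fun t => g t - Function.leftLim g b)
      (rightD b β fun s => g s - Function.leftLim g b) := by
  refine ⟨(memLp_top_rightD hβ hg h).mono_exponent le_top, ?_⟩
  have h1 := (measurePreserving_neg_leb' a b).quasiMeasurePreserving.ae
    (ae_eq_leftRL_leftD hβ (aemeasurable_reflect hg (Function.leftLim g b))
      (normW1_reflect_lt_top h))
  filter_upwards [h1] with t ht
  rw [rightRL_rightD hβ.1, ← ht, neg_neg]

/-! ### The limit at the left endpoint -/

/-- On `(c, d)` the weight `(s - t)^(-β-1)` is at least `(d - t)^(-β-1)`, so the weighted integral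
in the norm controls the unweighted one. -/
lemma integral_abs_sub_le (hβ : 0 < β) (hg : AEMeasurable g (leb a b)) (h : normWInf a b β g < ∞)
    {t c d : ℝ} (hat : a < t) (htc : t ≤ c) (hcd : c < d) (hdb : d ≤ b) :
    IntegrableOn (fun s => |g t - g s|) (Ioo c d) ∧
      ∫ s in Ioo c d, |g t - g s| ≤ (d - t) ^ (β + 1) * (normWInf a b β g).toReal := by
  have ht : t ∈ Ioo a b := ⟨hat, by linarith⟩
  have hsub : Ioo c d ⊆ Ioo t b := Ioo_subset_Ioo htc hdb
  have hi : IntegrableOn (fun s => |(g t - g s) / (s - t) ^ (β + 1)|) (Ioo t b) :=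
    (integrableOn_of_normWInf hg h ht).abs
  have hi2 : IntegrableOn
      (fun s => (d - t) ^ (β + 1) * |(g t - g s) / (s - t) ^ (β + 1)|) (Ioo c d) :=
    (hi.mono_set hsub).const_mul _
  have hle : ∀ s ∈ Ioo c d, |g t - g s| ≤ (d - t) ^ (β + 1) * |(g t - g s) / (s - t) ^ (β + 1)| := by
    intro s hs
    have h0 : 0 < s - t := by linarith [hs.1]
    have h1 : 0 < (s - t) ^ (β + 1) := by positivity
    rw [abs_div, abs_of_pos h1, mul_div_assoc', le_div_iff₀ h1, mul_comm]
    gcongr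
    exact hs.2.le
  have hi3 : IntegrableOn (fun s => |g t - g s|) (Ioo c d) := by
    have hm : AEMeasurable g (volume.restrict (Ioo c d)) :=
      hg.mono_measure (Measure.restrict_mono (Ioo_subset_Ioo (by linarith) hdb) le_rfl)
    refine hi2.mono' (hm.const_sub _).aestronglyMeasurable.norm ?_
    refine (ae_restrict_iff' measurableSet_Ioo).2 (Eventually.of_forall fun s hs => ?_)
    rw [Real.norm_eq_abs, abs_abs]
    exact hle s hs
  refine ⟨hi3, (setIntegral_mono_on hi3 hi2 measurableSet_Ioo hle).trans ?_⟩
  rw [integral_const_mul]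
  have h0 : 0 < d - t := by linarith
  have h1 : 0 < b - t := by linarith [ht.2]
  refine mul_le_mul_of_nonneg_left ?_ (by positivity)
  refine (setIntegral_mono_set hi (Eventually.of_forall fun _ => abs_nonneg _)
    hsub.eventuallyLE).trans (le_trans ?_ (abs_div_add_integral_le hg h ht))
  exact le_add_of_nonneg_left (by positivity)

/-- A function of finite `W^β_∞(b-)` norm is Hölder continuous away from `b`. -/
lemma abs_sub_le_rpow (hβ : 0 < β) (hg : AEMeasurable g (leb a b)) (h : normWInf a b β g < ∞)
    {t t' : ℝ} (hat : a < t) (htt' : t < t') (hb : t' + (t' - t) ≤ b) :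
    |g t - g t'| ≤ (2 ^ (β + 1) + 1) * (normWInf a b β g).toReal * (t' - t) ^ β := by
  set η := t' - t with hη
  have hη0 : 0 < η := sub_pos.2 htt'
  obtain ⟨i1, k1⟩ := integral_abs_sub_le hβ hg h hat htt'.le (show t' < t' + η by linarith) hb
  obtain ⟨i2, k2⟩ := integral_abs_sub_le hβ hg h (hat.trans htt') le_rfl
    (show t' < t' + η by linarith) hb
  -- Average the triangle inequality through `g s` over a window of length `η` to the right of `t'`;
  -- this needs the room `t' + η ≤ b`.
  have k3 : η * |g t - g t'| ≤
      (∫ s in Ioo t' (t' + η), |g t - g s|) + ∫ s in Ioo t' (t' + η), |g t' - g s| := by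
    have : η * |g t - g t'| = ∫ _ in Ioo t' (t' + η), |g t - g t'| := by
      simp [hη0.le]
    rw [this, ← integral_add i1 i2]
    refine setIntegral_mono_on (by simp) (i1.add i2) measurableSet_Ioo fun s _ => ?_
    rw [abs_sub_comm (g t')]
    exact abs_sub_le _ _ _
  have e1 : (t' + η - t) ^ (β + 1) = 2 ^ (β + 1) * (η ^ β * η) := by
    rw [show t' + η - t = 2 * η by rw [hη]; ring, Real.mul_rpow (by norm_num) hη0.le,
      Real.rpow_add hη0, Real.rpow_one]
  have e2 : (t' + η - t') ^ (β + 1) = η ^ β * η := by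
    rw [add_sub_cancel_left, Real.rpow_add hη0, Real.rpow_one]
  rw [e1] at k1
  rw [e2] at k2
  refine le_of_mul_le_mul_left ?_ hη0
  linarith

lemma exists_tendsto_nhdsGT (hab : a < b) (hβ : 0 < β) (hg : AEMeasurable g (leb a b))
    (h : normWInf a b β g < ∞) : ∃ ga : ℝ, Tendsto g (𝓝[>] a) (𝓝 ga) := by
  rw [← cauchy_map_iff_exists_tendsto, Metric.cauchy_iff]
  refine ⟨inferInstance, fun ε hε => ?_⟩
  set K := (2 ^ (β + 1) + 1) * (normWInf a b β g).toReal with hK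
  have hK0 : 0 ≤ K := by positivity
  have hlim : Tendsto (fun η : ℝ => K * η ^ β) (𝓝[>] 0) (𝓝 (K * 0 ^ β)) :=
    (((Real.continuous_rpow_const hβ.le).tendsto 0).const_mul K).mono_left nhdsWithin_le_nhds
  rw [Real.zero_rpow hβ.ne', mul_zero] at hlim
  -- With `η < (b - a) / 2`, points of `(a, a + η)` leave the room to the right that the Hölder
  -- estimate requires.
  obtain ⟨η, h1, h2, h3⟩ := ((hlim.eventually (gt_mem_nhds hε)).and
    (Ioo_mem_nhdsGT (show 0 < (b - a) / 2 by linarith))).exists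
  have key : ∀ t ∈ Ioo a (a + η), ∀ t' ∈ Ioo a (a + η), t < t' → |g t - g t'| < ε := by
    intro t ht t' ht' htt'
    refine (abs_sub_le_rpow hβ hg h ht.1 htt' (by linarith [ht.1, ht'.2])).trans_lt
      (lt_of_le_of_lt ?_ h1)
    have : 0 ≤ t' - t := by linarith
    gcongr
    linarith [ht.1, ht'.2]
  refine ⟨g '' Ioo a (a + η), image_mem_map (Ioo_mem_nhdsGT (by linarith)), ?_⟩
  rintro _ ⟨t, ht, rfl⟩ _ ⟨t', ht', rfl⟩
  rw [Real.dist_eq]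
  rcases lt_trichotomy t t' with hlt | rfl | hlt
  · exact key t ht t' ht' hlt
  · simpa using hε
  · rw [abs_sub_comm]
    exact key t' ht' t ht hlt

/-- If a Riemann-Liouville integral of a bounded function has a limit at the left endpoint, this
is the value of the integral there. -/
lemma sub_eq_rightRL_of_tendsto (hab : a < b) (hβ : 0 < β) {ψ : ℝ → ℂ} {ga gb : ℝ}
    (hψ : MemLp ψ ∞ (leb a b)) (hga : Tendsto g (𝓝[>] a) (𝓝 ga))
    (h : IsRightRLDeriv a b β (fun t => g t - gb) ψ) :
    ((ga - gb : ℝ) : ℂ) = (-1 : ℂ) ^ (-β : ℂ) *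
      ∫ t in Ioo a b, (((Real.Gamma β)⁻¹ * ((t - a) ^ (1 - β))⁻¹ : ℝ) : ℂ) * ψ t := by
  have h1 := (ae_eq_rightRL_iff hβ.le _ ψ).1 h.2
  rw [fracInt_of_pos _ hβ] at h1
  have hc : Continuous (conv (rlKernel (b - a) β) (rightExt a b ψ)) :=
    continuous_conv le_rfl le_top (by simp)
      (memLp_one_iff_integrable.2 (integrable_rlKernel _ hβ)) (memLp_rightExt hψ)
  have hneg : Tendsto (fun x : ℝ => -x) (𝓝[<] (-a)) (𝓝[>] a) := by
    simpa using tendsto_neg_nhdsLT (a := -a)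
  have h2 : Tendsto (rightExt a b fun t => ((g t - gb : ℝ) : ℂ)) (𝓝[<] (-a))
      (𝓝 ((ga - gb : ℝ) : ℂ)) := by
    have := (Complex.continuous_ofReal.tendsto _).comp ((hga.comp hneg).sub_const gb)
    refine this.congr' ?_
    filter_upwards [Ioo_mem_nhdsLT (show -b < -a by linarith)] with x hx
    have := rightExt_neg_of_mem (fun t => ((g t - gb : ℝ) : ℂ))
      (show -x ∈ Ioo a b from ⟨by linarith [hx.2], by linarith [hx.1]⟩)
    rw [neg_neg] at this
    rw [this]
    rfl
  have h3 := ((hc.tendsto (-a)).const_mul ((-1 : ℂ) ^ (-β : ℂ))).mono_left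
    (nhdsWithin_le_nhds (s := Iio (-a)))
  -- Almost everywhere equality gives coincidence at points accumulating at `-a`, which suffices
  -- since both sides have limits there.
  have h4 : ∃ᶠ x in 𝓝[<] (-a), x < -a → rightExt a b (fun t => ((g t - gb : ℝ) : ℂ)) x =
      (-1 : ℂ) ^ (-β : ℂ) * conv (rlKernel (b - a) β) (rightExt a b ψ) x := by
    rw [frequently_iff]
    intro U hU
    obtain ⟨l, hl, hlU⟩ := (mem_nhdsLT_iff_exists_Ioo_subset).1 hU
    obtain ⟨x, hx, hx2⟩ := (Measure.dense_of_ae h1).exists_mem_open isOpen_Ioo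
      (nonempty_Ioo.2 hl)
    exact ⟨x, hlU hx2, hx⟩
  have h5 := tendsto_nhds_unique_of_frequently_eq h2 h3
    ((h4.and_eventually self_mem_nhdsWithin).mono fun x hx => hx.1 hx.2)
  rw [h5, conv_comm, conv, ← integral_neg_eq_self, ← integral_indicator measurableSet_Ioo]
  congr 2; ext s
  by_cases hs : s ∈ Ioo a b
  · rw [indicator_of_mem hs, rightExt_neg_of_mem ψ hs, neg_sub_neg,
      rlKernel_of_mem ⟨by linarith [hs.1], by linarith [hs.2]⟩, ← neg_sub 1 β,
      Real.rpow_neg (by linarith [hs.1])]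
    push_cast
    ring
  · rw [indicator_of_notMem hs, rightExt, neg_neg, indicator_of_notMem hs, zero_mul]

end

end ZahleStieltjes

/-! ### The proposition -/

theorem mainTheorem8 (a b : ℝ) (hab : a < b) (α : ℝ) (hα : α ∈ Set.Ioo (0 : ℝ) 1)
    (f g : ℝ → ℝ) (hf : ZahleStieltjes.MemW1 a b α f)
    (hg : ZahleStieltjes.MemWInf a b (1 - α) g) :
    -- the integral exists, with the given `α` and `p = 1`, `q = ∞`
    ZahleStieltjes.HasZSIntegralAt a b f g α 1 ∞ (ZahleStieltjes.zsIntegral a b f g : ℂ) ∧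
    -- its value does not depend on the admissible parameters
    (∀ J : ℂ, ZahleStieltjes.HasZSIntegral a b f g J →
      J = (ZahleStieltjes.zsIntegral a b f g : ℂ)) ∧
    -- the two Weyl-Marchaud derivatives are given by absolutely convergent integrals
    (∀ᵐ t ∂(volume.restrict (Ioo a b)),
      IntegrableOn (fun s => (f t - f s) / (t - s) ^ (α + 1)) (Ioo a t)) ∧
    (∀ t ∈ Ioo a b, IntegrableOn (fun s => (g t - g s) / (s - t) ^ ((1 - α) + 1)) (Ioo t b)) ∧
    -- the defining formula, written with Weyl-Marchaud derivatives
    IntegrableOn (fun t =>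
      (ZahleStieltjes.leftD a α (fun s => f s - Function.rightLim f a) t : ℂ) *
        ZahleStieltjes.rightD b (1 - α) (fun s => g s - Function.leftLim g b) t) (Ioo a b) ∧
    (ZahleStieltjes.zsIntegral a b f g : ℂ) =
      (-1 : ℂ) ^ (α : ℂ) * (∫ t in Ioo a b,
        (ZahleStieltjes.leftD a α (fun s => f s - Function.rightLim f a) t : ℂ) *
          ZahleStieltjes.rightD b (1 - α) (fun s => g s - Function.leftLim g b) t) +
      ((Function.rightLim f a * (Function.leftLim g b - Function.rightLim g a) : ℝ) : ℂ) ∧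
    -- the representation with `f` in place of `f - f(a+)` and without the boundary term
    IntegrableOn (fun t => (ZahleStieltjes.leftD a α f t : ℂ) *
        ZahleStieltjes.rightD b (1 - α) (fun s => g s - Function.leftLim g b) t) (Ioo a b) ∧
    (ZahleStieltjes.zsIntegral a b f g : ℂ) =
      (-1 : ℂ) ^ (α : ℂ) * (∫ t in Ioo a b, (ZahleStieltjes.leftD a α f t : ℂ) *
        ZahleStieltjes.rightD b (1 - α) (fun s => g s - Function.leftLim g b) t) ∧
    -- the bound
    |ZahleStieltjes.zsIntegral a b f g| ≤
      (ZahleStieltjes.normW1 a b α f).toReal * (ZahleStieltjes.normWInf a b (1 - α) g).toReal /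
        (Real.Gamma α * Real.Gamma (1 - α)) := by
  obtain ⟨hfm, ⟨fa, hfa⟩, hfW⟩ := hf
  obtain ⟨hgm, ⟨gb, hgb⟩, hgW⟩ := hg
  have h1α : 1 - α ∈ Ioo (0 : ℝ) 1 := ⟨sub_pos.2 hα.2, sub_lt_self _ hα.1⟩
  obtain ⟨ga, hga⟩ := ZahleStieltjes.exists_tendsto_nhdsGT hab h1α.1 hgm hgW
  have efa : Function.rightLim f a = fa := rightLim_eq_of_tendsto hfa
  have ega : Function.rightLim g a = ga := rightLim_eq_of_tendsto hga
  have egb : Function.leftLim g b = gb := leftLim_eq_of_tendsto hgb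
  have hψ := ZahleStieltjes.memLp_top_rightD h1α hgm hgW
  have hψ' := ZahleStieltjes.isRightRLDeriv_rightD h1α hgm hgW
  have hψR := ZahleStieltjes.rightD_eq b (1 - α) g
  have hRm := ZahleStieltjes.aestronglyMeasurable_rightDReal (β := 1 - α) hgm hgW
  have hRb : ∀ᵐ t ∂(ZahleStieltjes.leb a b), ‖ZahleStieltjes.rightDReal b (1 - α) g t‖ ≤
      (ZahleStieltjes.normWInf a b (1 - α) g).toReal / Real.Gamma (1 - (1 - α)) :=
    (ae_restrict_iff' measurableSet_Ioo).2 (Eventually.of_forall fun t ht =>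
      ZahleStieltjes.abs_rightDReal_le h1α hgm hgW ht)
  have hfm' : AEMeasurable (fun s => f s - fa) (ZahleStieltjes.leb a b) := hfm.sub_const fa
  have hfW' := ZahleStieltjes.normW1_sub_const_lt_top hα.2 hfW fa
  have hφi := ZahleStieltjes.integrable_leftD hfm' hfW'
  have hDi := ZahleStieltjes.integrable_leftD hfm hfW
  have hφ1 := memLp_one_iff_integrable.2 hφi
  have hφ := ZahleStieltjes.ae_eq_leftRL_leftD hα hfm' hfW'
  have hend := ZahleStieltjes.sub_eq_rightRL_of_tendsto hab h1α.1 hψ hga hψ'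
  rw [efa, ega, egb]
  rw [egb] at hψ hψ' hψR hend
  rw [sub_sub_cancel] at hend hRb
  set φ := ZahleStieltjes.leftD a α (fun s => f s - fa) with hφdef
  set D := ZahleStieltjes.leftD a α f with hD
  set ψ := ZahleStieltjes.rightD b (1 - α) (fun s => g s - gb) with hψdef
  set R := ZahleStieltjes.rightDReal b (1 - α) g with hR
  set N := (ZahleStieltjes.normWInf a b (1 - α) g).toReal with hN
  -- The two phases combine to `exp (i π) = -1`; this is why the integral is real.
  have hsign : (-1 : ℂ) ^ (α : ℂ) * (-1 : ℂ) ^ ((1 - α : ℝ) : ℂ) = -1 := by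
    rw [ZahleStieltjes.neg_one_cpow_mul, add_sub_cancel]
    simp
  have hreal : ∀ θ : ℝ → ℝ, (-1 : ℂ) ^ (α : ℂ) * ∫ t in Ioo a b, (θ t : ℂ) * ψ t =
      ((-∫ t in Ioo a b, θ t * R t : ℝ) : ℂ) := by
    intro θ
    have : ∀ t, (θ t : ℂ) * ψ t = (-1 : ℂ) ^ ((1 - α : ℝ) : ℂ) * ((θ t * R t : ℝ) : ℂ) := by
      intro t
      rw [hψR t]
      push_cast
      ring
    simp only [this]
    rw [integral_const_mul, ← mul_assoc, hsign, integral_complex_ofReal]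
    push_cast
    ring
  have hint : ∀ θ : ℝ → ℝ, Integrable θ (ZahleStieltjes.leb a b) →
      IntegrableOn (fun t => (θ t : ℂ) * ψ t) (Ioo a b) := fun θ hθ =>
    memLp_one_iff_integrable.1 (hψ.mul' (memLp_one_iff_integrable.2 hθ).ofReal)
  set I : ℝ := (-∫ t in Ioo a b, φ t * R t) + fa * (gb - ga) with hI
  have hIeq : (I : ℂ) = (-1 : ℂ) ^ (α : ℂ) * (∫ t in Ioo a b, (φ t : ℂ) * ψ t) +
      ((fa * (gb - ga) : ℝ) : ℂ) := by
    rw [hreal, hI, Complex.ofReal_add]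
  have hat : ZahleStieltjes.HasZSIntegralAt a b f g α 1 ∞ (I : ℂ) :=
    ⟨hfm, hgm, fa, ga, gb, hfa, hga, hgb, φ, ψ, hφ1, ⟨hφ1, hφ⟩, hψ, hψ', hIeq⟩
  have hHas : ZahleStieltjes.HasZSIntegral a b f g (I : ℂ) :=
    ⟨α, 1, ∞, ⟨hα.1.le, hα.2.le⟩, le_rfl, le_top, by simp, hat⟩
  have hzs : ZahleStieltjes.zsIntegral a b f g = I := ZahleStieltjes.zsIntegral_eq hHas
  rw [hzs]
  have hsecond : (I : ℂ) = (-1 : ℂ) ^ (α : ℂ) * ∫ t in Ioo a b, (D t : ℂ) * ψ t := by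
    have hk : Integrable (fun t => fa * ((Real.Gamma (1 - α))⁻¹ * ((t - a) ^ α)⁻¹))
        (ZahleStieltjes.leb a b) :=
      ((ZahleStieltjes.integrable_inv_rpow hα.2).const_mul _).const_mul _
    -- Split off the derivative of the constant `f(a+)`; its pairing with `ψ` must reproduce the
    -- boundary term.
    have hsplit : ∀ t, (D t : ℂ) * ψ t = (φ t : ℂ) * ψ t +
        ((fa * ((Real.Gamma (1 - α))⁻¹ * ((t - a) ^ α)⁻¹) : ℝ) : ℂ) * ψ t := by
      intro t
      rw [hφdef, ZahleStieltjes.leftD_sub_const, ← hD]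
      push_cast
      ring
    simp only [hsplit]
    rw [integral_add (hint φ hφi) (hint _ hk), mul_add, hIeq]
    congr 1
    have hfac : ∀ t, ((fa * ((Real.Gamma (1 - α))⁻¹ * ((t - a) ^ α)⁻¹) : ℝ) : ℂ) * ψ t =
        (fa : ℂ) * ((((Real.Gamma (1 - α))⁻¹ * ((t - a) ^ α)⁻¹ : ℝ) : ℂ) * ψ t) := by
      intro t
      rw [Complex.ofReal_mul, mul_assoc]
    simp only [hfac]
    rw [integral_const_mul]
    have hinv := ZahleStieltjes.neg_one_cpow_neg_mul (1 - α)
    -- The integral is, up to phase, `I^(1-α)_{b-} ψ` at the endpoint `a`, hence `g(a+) - g(b-)`.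
    have hK : ∫ t in Ioo a b, (((Real.Gamma (1 - α))⁻¹ * ((t - a) ^ α)⁻¹ : ℝ) : ℂ) * ψ t =
        (-1 : ℂ) ^ ((1 - α : ℝ) : ℂ) * ((ga - gb : ℝ) : ℂ) := by
      rw [hend, ← mul_assoc, hinv, one_mul]
    rw [hK, mul_left_comm, ← mul_assoc ((-1 : ℂ) ^ (α : ℂ)), hsign]
    push_cast
    ring
  refine ⟨hat, fun J hJ => ZahleStieltjes.HasZSIntegral.unique hJ hHas,
    ZahleStieltjes.ae_integrableOn_leftD hfm hfW,
    fun t ht => ZahleStieltjes.integrableOn_of_normWInf hgm hgW ht, hint φ hφi, hIeq,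
    hint D hDi, hsecond, ?_⟩
  rw [hreal] at hsecond
  have hI2 : I = -∫ t in Ioo a b, D t * R t := by exact_mod_cast hsecond
  have hΓ : 0 < Real.Gamma α := Real.Gamma_pos_of_pos hα.1
  rw [hI2, abs_neg]
  calc |∫ t in Ioo a b, D t * R t| ≤ ∫ t in Ioo a b, |D t| * (N / Real.Gamma α) := by
        rw [← Real.norm_eq_abs]
        refine norm_integral_le_of_norm_le (hDi.abs.mul_const _) ?_
        filter_upwards [hRb] with t ht
        rw [norm_mul]
        exact mul_le_mul_of_nonneg_left ht (norm_nonneg _)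
    _ = (∫ t in Ioo a b, |D t|) * (N / Real.Gamma α) := integral_mul_const _ _
    _ ≤ ((Real.Gamma (1 - α))⁻¹ * (ZahleStieltjes.normW1 a b α f).toReal) *
        (N / Real.Gamma α) :=
      mul_le_mul_of_nonneg_right (ZahleStieltjes.integral_abs_leftD_le hα hfm hfW) (by positivity)
    _ = _ := by
      field_simp
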